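/- Notation. $(ID,*)$ is the set of infinitely divisible probability measures on $\mathbb R$; $\mu=[a,\sigma^2,M]$ means that $$\int e^{iux}\mu(dx)=\exp\Big(iua-\tfrac12\sigma^2u^2+\int_{\mathbb R\setminus\{0\}}\big(e^{iux}-1-\tfrac{iux}{1+x^2}\big)M(dx)\Big),\qquad u\in\mathbb R,$$ with $a\in\mathbb R$, $\sigma^2\ge 0$ and $M$ a Lévy measure ($\int_{\mathbb R\setminus\{0\}}\min(1,x^2)M(dx)<\infty$). For an integer $k\ge 1$ and $\mu\in(ID,*)$, let $I_k(\mu)=I^{t,t^k}_{(0,1]}(\mu)$ be the law of $\int_{(0,1]}t\,dY(t^k)$, where $Y$ is a Lévy process such that $Y(1)$ has law $\mu$, and let $(\mathbb U_k,*)=\{I_k(\mu):\mu\in(ID,*)\}$. For a probability measure $\tilde\nu$ on $\mathbb R$ with Cauchy transform $G_{\tilde\nu}(z)=\int (z-x)^{-1}\tilde\nu(dx)$ and $F_{\tilde\nu}=1/G_{\tilde\nu}$, let $V_{\tilde\nu}(z)=F_{\tilde\nu}^{-1}(z)-z$ be its Voiculescu transform, continued analytically to the upper half-plane; a statement about $V_{\tilde\nu}(it)$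 for all $t>0$ includes that this continuation exists. The measure $\tilde\nu$ is the free-probability counterpart of $\nu\in(ID,*)$ with characteristic function $\phi_\nu$ if $$V_{\tilde\nu}(it)=it^2\int_0^\infty\log\phi_\nu(-u)\,e^{-tu}\,du,\qquad t>0,$$ and $(\mathbb U_k,\boxplus)$ is the set of the free-probability counterparts of the elements of $(\mathbb U_k,*)$. Finally $\Phi(z,1,k)$ is the Hurwitz–Lerch function, that is, the analytic continuation to $\mathbb C\setminus[1,\infty)$ of $\sum_{n\ge 0}z^n/(k+n)$, $|z|<1$. Proposition. Let $k\ge 1$ be an integer and $\tilde\nu$ a probability measure on $\mathbb R$. (i) $\tilde\nu\in(\mathbb U_k,\boxplus)$ if and only if there are $a\in\mathbb R$, $\sigma^2\ge 0$ and a Lévy measure $M$ such that, for all $t>0$, $$V_{\tilde\nu}(it)=\frac{k}{k+1}\,a+\frac{k}{k+2}\,\frac{\sigma^2}{it}+\int_{\mathbb R\setminus\{0\}}\Big[k\,it\,\Phi\big(\tfrac{x}{it},1,k\big)-it-\frac{k}{k+1}\,\frac{x}{1+x^2}\Big]M(dx).\qquad(*)$$ (ii) More precisely, if $\mu=[a,\sigma^2,M]\in(ID,*)$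 and $\nu=I_k(\mu)$, then $\tilde\nu$ is the free-probability counterpart of $\nu$ if and only if $(*)$ holds with these $a,\sigma^2,M$ for all $t>0$. (iii) For all $a\in\mathbb R$, $\sigma^2\ge0$ and every Lévy measure $M$, the measure $m(dx)=\frac{x^2}{1+x^2}M(dx)$ on $\mathbb R\setminus\{0\}$, $m(\{0\})=\sigma^2$, is finite, and for all $t>0$ the right-hand side of $(*)$ equals $$\frac{k}{k+1}\,a+\int_{\mathbb R}\Big[k\,it\Big(\Phi\big(\tfrac{x}{it},1,k\big)-\frac1k\Big)-\frac{k}{k+1}\,\frac{x}{1+x^2}\Big]\frac{1+x^2}{x^2}\,m(dx),$$ where the integrand at $x=0$ is $\frac{k}{k+2}\frac1{it}$; both integrals converge absolutely. -/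

import Mathlib

open MeasureTheory ProbabilityTheory Filter Topology Set
open scoped NNReal ENNReal BoundedContinuousFunction

noncomputable section

/-! ### Classical infinite divisibility -/

/-- The `n`-fold convolution power `ν ∗ ⋯ ∗ ν`. -/
def convPower (ν : Measure ℝ) : ℕ → Measure ℝ
  | 0 => Measure.dirac 0
  | n + 1 => convPower ν n ∗ ν

/-- `μ ∈ (ID, ∗)`: for every `n ≥ 1`, `μ` is the `n`-th convolution power of a probability
measure. -/
def IsInfinitelyDivisible (μ : Measure ℝ) : Prop :=
  IsProbabilityMeasure μ ∧
    ∀ n : ℕ, 1 ≤ n → ∃ ν : Measure ℝ, IsProbabilityMeasure ν ∧ convPower ν n = μ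

/-- `M` is a Lévy (spectral) measure on `ℝ ∖ {0}`, seen as a measure on `ℝ` without atom at `0`. -/
def IsLevyMeasure (M : Measure ℝ) : Prop :=
  M {0} = 0 ∧ ∫⁻ x, ENNReal.ofReal (min 1 (x ^ 2)) ∂M < ∞

/-- `μ = [a, σ², M]`: the Lévy–Khintchine formula for the characteristic function of `μ`. -/
def HasLevyTriplet (μ : Measure ℝ) (a : ℝ) (σsq : ℝ≥0) (M : Measure ℝ) : Prop :=
  IsLevyMeasure M ∧ ∀ u : ℝ, charFun μ u =
    Complex.exp (Complex.I * u * a - (1 / 2) * ((σsq : ℝ) : ℂ) * u ^ 2 +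
      ∫ x in ({0}ᶜ : Set ℝ), (Complex.exp (Complex.I * u * x) - 1 -
        Complex.I * u * x / (1 + (x : ℂ) ^ 2)) ∂M)

/-- `ψ = log φ_μ`: the continuous logarithm of the characteristic function of `μ` vanishing
at `0`. -/
def IsLogCharFun (μ : Measure ℝ) (ψ : ℝ → ℂ) : Prop :=
  Continuous ψ ∧ ψ 0 = 0 ∧ ∀ u : ℝ, Complex.exp (ψ u) = charFun μ u

/-! ### Lévy processes and random integrals -/

/-- `κ t`, `t ≥ 0`, are the laws of `Y (s + t) - Y s` for a Lévy process `Y`, that is,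
a weakly continuous convolution semigroup of probability measures. -/
structure IsLevySemigroup (κ : ℝ≥0 → Measure ℝ) : Prop where
  prob : ∀ t, IsProbabilityMeasure (κ t)
  zero : κ 0 = Measure.dirac 0
  add : ∀ s t, κ (s + t) = κ s ∗ κ t
  cont : ∀ f : ℝ →ᵇ ℝ, Tendsto (fun t => ∫ x, f x ∂(κ t)) (𝓝 0) (𝓝 (f 0))

/-- The law of the Riemann–Stieltjes sum
`∑ j < n, h (t j) * (Y (r (t (j + 1))) - Y (r (t j)))`, for `Y` a Lévy process whose increments
have laws `κ`, `r` non-decreasing and `t 0 ≤ t 1 ≤ ⋯ ≤ t n`. -/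
def stieltjesSumLaw (κ : ℝ≥0 → Measure ℝ) (h r : ℝ → ℝ) (t : ℕ → ℝ) : ℕ → Measure ℝ
  | 0 => Measure.dirac 0
  | n + 1 => stieltjesSumLaw κ h r t n ∗
      (κ (r (t (n + 1)) - r (t n)).toNNReal).map (fun x => h (t n) * x)

/-- `t n 0 ≤ t n 1 ≤ ⋯ ≤ t n (N n)`, `n ∈ ℕ`, are partitions of `[a, b]` whose mesh tends
to `0`. -/
structure IsPartitionSeq (a b : ℝ) (N : ℕ → ℕ) (t : ℕ → ℕ → ℝ) : Prop where
  mono : ∀ n, Monotone (t n)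
  left : ∀ n, t n 0 = a
  right : ∀ n, t n (N n) = b
  mesh : ∀ ε > 0, ∀ᶠ n in atTop, ∀ j < N n, t n (j + 1) - t n j < ε

/-- `ρ = I^{h,r}_{(a,b]}(μ)`: `ρ` is the law of `∫_{(a,b]} h(t) dY(r(t))`, where `Y` is the Lévy
process with `Y(1)` of law `μ`, `h` is continuous and `r` is non-decreasing and nonnegative. The
integral is the limit of Riemann–Stieltjes sums, and only its law matters; by
`IsLevyProcess.isUIntegral` below, the law of the pathwise integral with respect to a càdlàg Lévy
process satisfies this definition. -/
def IsRandomIntegral (h r : ℝ → ℝ) (a b : ℝ) (μ ρ : Measure ℝ) : Prop :=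
  IsProbabilityMeasure ρ ∧ ∃ κ : ℝ≥0 → Measure ℝ, IsLevySemigroup κ ∧ κ 1 = μ ∧
    ∀ (N : ℕ → ℕ) (t : ℕ → ℕ → ℝ), IsPartitionSeq a b N t →
      ∀ f : ℝ →ᵇ ℝ,
        Tendsto (fun n => ∫ x, f x ∂(stieltjesSumLaw κ h r (t n) (N n))) atTop (𝓝 (∫ x, f x ∂ρ))

/-- `I^{t,t^k}_{(0,1]}`: the law of `∫_{(0,1]} t dY(t^k)`. -/
def IsUIntegral (k : ℕ) (μ ρ : Measure ℝ) : Prop :=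
  IsRandomIntegral (fun t => t) (fun t => t ^ k) 0 1 μ ρ

/-- The class `(𝕌_k, ∗) = I^{t,t^k}_{(0,1]}(ID)`. -/
def ClassU (k : ℕ) (ν : Measure ℝ) : Prop :=
  ∃ μ : Measure ℝ, IsInfinitelyDivisible μ ∧ IsUIntegral k μ ν

/-- A càdlàg Lévy process on `[0, ∞)`. -/
structure IsLevyProcess {Ω : Type*} [MeasurableSpace Ω] (Y : ℝ≥0 → Ω → ℝ) (P : Measure Ω) :
    Prop where
  measurable : ∀ t, Measurable (Y t)
  zero : ∀ ω, Y 0 ω = 0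
  indep : HasIndepIncrements Y P
  stationary : ∀ s t, P.map (fun ω => Y (s + t) ω - Y s ω) = P.map (Y t)
  right_cont : ∀ ω t, ContinuousWithinAt (fun s => Y s ω) (Ici t) t
  left_lim : ∀ ω t, ∃ l, Tendsto (fun s => Y s ω) (𝓝[<] t) (𝓝 l)

theorem IsPartitionSeq.nonneg {N : ℕ → ℕ} {t : ℕ → ℕ → ℝ} (ht : IsPartitionSeq 0 1 N t)
    (n j : ℕ) : 0 ≤ t n j := by
  rw [← ht.left n]; exact ht.mono n (Nat.zero_le j)

theorem IsPartitionSeq.le_one {N : ℕ → ℕ} {t : ℕ → ℕ → ℝ} (ht : IsPartitionSeq 0 1 N t)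
    {n j : ℕ} (hj : j ≤ N n) : t n j ≤ 1 := by
  rw [← ht.right n]; exact ht.mono n hj

/-- Riemann–Stieltjes sums of `∫_{(0,1]} s dy(s)` converge to its value by parts,
`y 1 - ∫_0^1 y(s) ds`. -/
theorem tendsto_stieltjesSum {y : ℝ → ℝ} {C : ℝ} (hC : ∀ s ∈ Icc (0 : ℝ) 1, |y s| ≤ C)
    (hy : ∀ s ∈ Ico (0 : ℝ) 1, ContinuousWithinAt y (Ici s) s)
    {N : ℕ → ℕ} {t : ℕ → ℕ → ℝ} (ht : IsPartitionSeq 0 1 N t) :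
    Tendsto (fun n => ∑ j ∈ Finset.range (N n), t n j * (y (t n (j + 1)) - y (t n j))) atTop
      (𝓝 (y 1 - ∫ s in (0 : ℝ)..1, y s)) := by
  have habel : ∀ n, ∀ K, ∑ j ∈ Finset.range K, t n j * (y (t n (j + 1)) - y (t n j)) =
      t n K * y (t n K) - t n 0 * y (t n 0) -
        ∑ j ∈ Finset.range K, (t n (j + 1) - t n j) * y (t n (j + 1)) := by
    intro n K
    induction K with
    | zero => simp
    | succ K ih => rw [Finset.sum_range_succ, Finset.sum_range_succ, ih]; ring
  let g : ℕ → ℝ → ℝ := fun n s => ∑ j ∈ Finset.range (N n),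
    (Ico (t n j) (t n (j + 1))).indicator (fun _ => y (t n (j + 1))) s
  have hgm : ∀ n, Measurable (g n) := by
    intro n
    refine Finset.measurable_fun_sum _ fun j _ => ?_
    exact measurable_const.indicator measurableSet_Ico
  -- the value of the step function
  have hgval : ∀ n, ∀ s ∈ Ico (0 : ℝ) 1, ∃ j < N n, s ∈ Ico (t n j) (t n (j + 1)) ∧
      g n s = y (t n (j + 1)) := by
    intro n s hs
    classical
    have hex : ∃ j, s < t n j := ⟨N n, by rw [ht.right]; exact hs.2⟩
    have h1 := Nat.find_spec hex
    have h0 : Nat.find hex ≠ 0 := by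
      intro h0
      rw [h0, ht.left] at h1
      exact absurd hs.1 (not_le.2 h1)
    obtain ⟨j, hj⟩ := Nat.exists_eq_succ_of_ne_zero h0
    have hjN : Nat.find hex ≤ N n := Nat.find_min' hex (by rw [ht.right]; exact hs.2)
    have hlow : t n j ≤ s := not_lt.1 (Nat.find_min hex (m := j) (by omega))
    rw [hj] at h1
    have hmem : s ∈ Ico (t n j) (t n (j + 1)) := ⟨hlow, h1⟩
    refine ⟨j, by omega, hmem, ?_⟩
    have : g n s = (Ico (t n j) (t n (j + 1))).indicator (fun _ => y (t n (j + 1))) s := by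
      refine Finset.sum_eq_single_of_mem j (Finset.mem_range.2 (by omega)) fun i _ hij => ?_
      refine indicator_of_notMem (fun hi => ?_) _
      rcases lt_or_gt_of_ne hij with h | h
      · exact absurd (hi.2.trans_le (ht.mono n (show i + 1 ≤ j by omega))) (not_lt.2 hlow)
      · exact absurd (h1.trans_le (ht.mono n (show j + 1 ≤ i by omega))) (not_lt.2 hi.1)
    rw [this, indicator_of_mem hmem]
  have hgint : ∀ n, ∫ s in Ico (0 : ℝ) 1, g n s =
      ∑ j ∈ Finset.range (N n), (t n (j + 1) - t n j) * y (t n (j + 1)) := by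
    intro n
    rw [integral_finsetSum]
    · refine Finset.sum_congr rfl fun j hj => ?_
      have hj' := Finset.mem_range.1 hj
      rw [setIntegral_indicator measurableSet_Ico, setIntegral_const, smul_eq_mul]
      have : Ico (0 : ℝ) 1 ∩ Ico (t n j) (t n (j + 1)) = Ico (t n j) (t n (j + 1)) :=
        inter_eq_right.2 (Ico_subset_Ico (ht.nonneg n j) (ht.le_one hj'))
      rw [this, Measure.real, Real.volume_Ico, ENNReal.toReal_ofReal
        (sub_nonneg.2 (ht.mono n (Nat.le_succ j)))]
    · intro j _
      exact (integrable_const _).indicator measurableSet_Ico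
  have hlim : Tendsto (fun n => ∫ s in Ico (0 : ℝ) 1, g n s) atTop
      (𝓝 (∫ s in Ico (0 : ℝ) 1, y s)) := by
    refine tendsto_integral_of_dominated_convergence (fun _ => C)
      (fun n => (hgm n).aestronglyMeasurable) (integrable_const _) ?_ ?_
    · intro n
      refine (ae_restrict_iff' measurableSet_Ico).2 (ae_of_all _ fun s hs => ?_)
      obtain ⟨j, hj, -, h⟩ := hgval n s hs
      rw [h]
      exact hC _ ⟨ht.nonneg n _, ht.le_one hj⟩
    · refine (ae_restrict_iff' measurableSet_Ico).2 (ae_of_all _ fun s hs => ?_)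
      refine Metric.tendsto_nhds.2 fun ε hε => ?_
      obtain ⟨δ, hδ, hδ'⟩ := Metric.continuousWithinAt_iff.1 (hy s hs) ε hε
      filter_upwards [ht.mesh δ hδ] with n hn
      obtain ⟨j, hj, hm, h⟩ := hgval n s hs
      rw [h]
      refine hδ' hm.2.le ?_
      rw [Real.dist_eq, abs_of_nonneg (sub_nonneg.2 hm.2.le)]
      linarith [hn j hj, hm.1]
  have e1 : ∫ s in (0 : ℝ)..1, y s = ∫ s in Ico (0 : ℝ) 1, y s := by
    rw [intervalIntegral.integral_of_le zero_le_one, integral_Ioc_eq_integral_Ioo,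
      integral_Ico_eq_integral_Ioo]
  rw [e1]
  refine (tendsto_const_nhds.sub hlim).congr fun n => ?_
  rw [habel, hgint, ht.left, ht.right]
  ring

/-- A function on `[0, ∞)` which is right-continuous with left limits is bounded on `[0, 1]`. -/
theorem exists_bound_of_cadlag {y : ℝ≥0 → ℝ} (hr : ∀ t, ContinuousWithinAt y (Ici t) t)
    (hl : ∀ t, ∃ l, Tendsto y (𝓝[<] t) (𝓝 l)) : ∃ C : ℝ, ∀ s ≤ 1, |y s| ≤ C := by
  have h : ∃ C : ℝ, ∀ s ∈ Icc (0 : ℝ≥0) 1, |y s| ≤ C := by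
    refine isCompact_Icc.induction_on (p := fun S => ∃ C : ℝ, ∀ s ∈ S, |y s| ≤ C)
      ⟨0, by simp⟩ (fun S T hST ⟨C, hC⟩ => ⟨C, fun s hs => hC s (hST hs)⟩) ?_ ?_
    · rintro S T ⟨C, hC⟩ ⟨D, hD⟩
      refine ⟨max C D, ?_⟩
      rintro s (hs | hs)
      · exact (hC s hs).trans (le_max_left _ _)
      · exact (hD s hs).trans (le_max_right _ _)
    · intro t _
      obtain ⟨l, hl⟩ := hl t
      have h1 : ∀ᶠ s in 𝓝[<] t, |y s| ≤ |l| + 1 :=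
        (hl.abs.eventually_lt_const (lt_add_one _)).mono fun _ h => h.le
      have h2 : ∀ᶠ s in 𝓝[≥] t, |y s| ≤ |y t| + 1 :=
        ((hr t).abs.tendsto.eventually_lt_const (lt_add_one _)).mono fun _ h => h.le
      have h3 : ∀ᶠ s in 𝓝 t, |y s| ≤ max (|l| + 1) (|y t| + 1) := by
        rw [← nhdsLT_sup_nhdsGE t, eventually_sup]
        exact ⟨h1.mono fun _ h => h.trans (le_max_left _ _),
          h2.mono fun _ h => h.trans (le_max_right _ _)⟩
      exact ⟨_, mem_nhdsWithin_of_mem_nhds h3, _, fun s hs => hs⟩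
  obtain ⟨C, hC⟩ := h
  exact ⟨C, fun s hs => hC s ⟨zero_le, hs⟩⟩

/-- For a càdlàg Lévy process `Y`, the law of the pathwise integral
`∫_{(0,1]} t dY(t^k) = Y(1) - ∫_0^1 Y(t^k) dt` (integration by parts) is `I^{t,t^k}_{(0,1]}` of
the law of `Y(1)`. -/
theorem IsLevyProcess.isUIntegral {Ω : Type*} [MeasurableSpace Ω] {Y : ℝ≥0 → Ω → ℝ}
    {P : Measure Ω} [IsProbabilityMeasure P] (hY : IsLevyProcess Y P) {k : ℕ} :
    IsUIntegral k (P.map (Y 1))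
      (P.map (fun ω => Y 1 ω - ∫ t in (0 : ℝ)..1, Y (t ^ k).toNNReal ω)) := by
  let Z : Ω → ℝ := fun ω => Y 1 ω - ∫ t in (0 : ℝ)..1, Y (t ^ k).toNNReal ω
  let S : (ℕ → ℝ) → ℕ → Ω → ℝ := fun t K ω => ∑ j ∈ Finset.range K,
    t j * (Y (t (j + 1) ^ k).toNNReal ω - Y (t j ^ k).toNNReal ω)
  have hSm : ∀ t K, Measurable (S t K) := fun t K =>
    Finset.measurable_fun_sum _ fun j _ =>
      ((hY.measurable _).sub (hY.measurable _)).const_mul _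
  -- convergence of the sums
  have hconv : ∀ (N : ℕ → ℕ) (t : ℕ → ℕ → ℝ), IsPartitionSeq 0 1 N t → ∀ ω,
      Tendsto (fun n => S (t n) (N n) ω) atTop (𝓝 (Z ω)) := by
    intro N t ht ω
    obtain ⟨C, hC⟩ := exists_bound_of_cadlag (hY.right_cont ω) (hY.left_lim ω)
    have := tendsto_stieltjesSum (y := fun s => Y (s ^ k).toNNReal ω) (C := C) ?_ ?_ ht
    · simpa [Z] using this
    · intro s hs
      refine hC _ ?_
      rw [Real.toNNReal_le_one]
      exact pow_le_one₀ hs.1 hs.2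
    · intro s hs
      refine (hY.right_cont ω (s ^ k).toNNReal).comp (f := fun s : ℝ => (s ^ k).toNNReal)
        (by fun_prop) ?_
      intro u hu
      exact Real.toNNReal_le_toNNReal (pow_le_pow_left₀ hs.1 hu k)
  -- measurability of the integral
  have hZm : Measurable Z := by
    let t : ℕ → ℕ → ℝ := fun n j => (j : ℝ) / (n + 1)
    have ht : IsPartitionSeq 0 1 (fun n => n + 1) t := by
      refine ⟨fun n i j hij => ?_, fun n => by simp [t], fun n => ?_, fun ε hε => ?_⟩
      · simp only [t]; gcongr
      · simp only [t]; push_cast; exact div_self (by positivity)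
      · have := (tendsto_one_div_add_atTop_nhds_zero_nat (𝕜 := ℝ)).eventually_lt_const hε
        filter_upwards [this] with n hn j _
        simp only [t]
        have : ((j + 1 : ℕ) : ℝ) / (n + 1) - (j : ℝ) / (n + 1) = 1 / (n + 1) := by
          push_cast; ring
        rwa [this]
    exact measurable_of_tendsto_metrizable (fun n => hSm (t n) (n + 1))
      (tendsto_pi_nhds.2 (hconv _ t ht))
  have hprob : ∀ t, IsProbabilityMeasure (P.map (Y t)) := fun t =>
    Measure.isProbabilityMeasure_map (hY.measurable t).aemeasurable
  refine ⟨Measure.isProbabilityMeasure_map hZm.aemeasurable, fun t => P.map (Y t),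
    ⟨hprob, ?_, ?_, ?_⟩, rfl, ?_⟩
  · have : Y 0 = fun _ => 0 := funext hY.zero
    simp [this]
  · intro s t
    have hind := hY.indep.indepFun_eval_sub (r := 0) (s := s) (t := s + t) zero_le
      le_self_add (ae_of_all _ hY.zero)
    have := hind.map_add_eq_map_conv_map (hY.measurable s)
      ((hY.measurable (s + t)).sub (hY.measurable s))
    rw [add_sub_cancel] at this
    rw [this]
    congr 1
    exact hY.stationary s t
  · intro f
    have h : ∀ t, ∫ x, f x ∂(P.map (Y t)) = ∫ ω, f (Y t ω) ∂P := fun t =>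
      integral_map (hY.measurable t).aemeasurable f.continuous.aestronglyMeasurable
    simp only [h]
    have : f 0 = ∫ _, f 0 ∂P := by simp
    rw [this]
    refine tendsto_integral_filter_of_dominated_convergence (fun _ => ‖f‖)
      (.of_forall fun t =>
        (f.continuous.measurable.comp (hY.measurable t)).aestronglyMeasurable)
      (.of_forall fun t => ae_of_all _ fun ω => f.norm_coe_le_norm _) (integrable_const _)
      (ae_of_all _ fun ω => ?_)
    have h0 := hY.right_cont ω 0
    have hI : Ici (0 : ℝ≥0) = univ := by ext; simp
    rw [hI, continuousWithinAt_univ] at h0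
    have := (f.continuous.tendsto _).comp h0.tendsto
    simpa [hY.zero, Function.comp_def] using this
  · intro N t ht f
    -- the law of the sums
    have hlaw : ∀ n K, stieltjesSumLaw (fun t => P.map (Y t)) (fun t => t) (fun t => t ^ k)
        (t n) K = P.map (S (t n) K) := by
      intro n K
      induction K with
      | zero => simp [stieltjesSumLaw, S]
      | succ K ih =>
        have hmono : Monotone fun j => (t n j ^ k).toNNReal := fun i j hij =>
          Real.toNNReal_le_toNNReal (pow_le_pow_left₀ (ht.nonneg n i) (ht.mono n hij) k)
        have hi := hY.indep.nat hmono
        have hi' := hi.comp (fun j x => t n j * x) (fun j => measurable_const_mul _)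
        have hind := hi'.indepFun_finsetSum_of_notMem
          (fun j => (measurable_const_mul _).comp ((hY.measurable _).sub (hY.measurable _)))
          (s := Finset.range K) (i := K) (by simp)
        have hdm : Measurable (fun ω =>
            Y (t n (K + 1) ^ k).toNNReal ω - Y (t n K ^ k).toNNReal ω) :=
          (hY.measurable _).sub (hY.measurable _)
        have hadd := hind.map_add_eq_map_conv_map
          (by convert hSm (t n) K using 1; ext ω; simp [S])
          ((measurable_const_mul _).comp hdm)
        have e1 : S (t n) (K + 1) = (∑ j ∈ Finset.range K, (fun x => t n j * x) ∘
            fun ω => Y (t n (j + 1) ^ k).toNNReal ω - Y (t n j ^ k).toNNReal ω) +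
            (fun x => t n K * x) ∘ fun ω =>
              Y (t n (K + 1) ^ k).toNNReal ω - Y (t n K ^ k).toNNReal ω := by
          ext ω; simp [S, Finset.sum_range_succ]
        have e2 : S (t n) K = ∑ j ∈ Finset.range K, (fun x => t n j * x) ∘
            fun ω => Y (t n (j + 1) ^ k).toNNReal ω - Y (t n j ^ k).toNNReal ω := by
          ext ω; simp [S]
        have hst : P.map (Y (t n (K + 1) ^ k - t n K ^ k).toNNReal) = P.map (fun ω =>
            Y (t n (K + 1) ^ k).toNNReal ω - Y (t n K ^ k).toNNReal ω) := by
          rw [← hY.stationary (t n K ^ k).toNNReal]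
          have hle : t n K ^ k ≤ t n (K + 1) ^ k :=
            pow_le_pow_left₀ (ht.nonneg n K) (ht.mono n (Nat.le_succ K)) k
          rw [← Real.toNNReal_add (pow_nonneg (ht.nonneg n K) k) (sub_nonneg.2 hle),
            add_sub_cancel]
        rw [stieltjesSumLaw, ih, hst, Measure.map_map (measurable_const_mul _) hdm, e1, hadd, ← e2]
    simp only [hlaw]
    have h : ∀ n, ∫ x, f x ∂(P.map (S (t n) (N n))) = ∫ ω, f (S (t n) (N n) ω) ∂P := fun n =>
      integral_map (hSm _ _).aemeasurable f.continuous.aestronglyMeasurable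
    have hZ : ∫ x, f x ∂(P.map Z) = ∫ ω, f (Z ω) ∂P :=
      integral_map hZm.aemeasurable f.continuous.aestronglyMeasurable
    simp only [h]
    change Tendsto _ _ (𝓝 (∫ x, f x ∂(P.map Z)))
    rw [hZ]
    refine tendsto_integral_of_dominated_convergence (fun _ => ‖f‖)
      (fun n => (f.continuous.measurable.comp (hSm _ _)).aestronglyMeasurable)
      (integrable_const _) (fun n => ae_of_all _ fun ω => f.norm_coe_le_norm _)
      (ae_of_all _ fun ω => ?_)
    exact (f.continuous.tendsto _).comp (hconv N t ht ω)

/-! ### Voiculescu transforms and free counterparts -/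

/-- The Cauchy transform `G_ν(z) = ∫ ν(dx) / (z - x)`. -/
def cauchyTransform (ν : Measure ℝ) (z : ℂ) : ℂ := ∫ x : ℝ, (z - x)⁻¹ ∂ν

/-- `V` is the Voiculescu transform `V_ν(z) = F_ν^{-1}(z) - z`, `F_ν = 1 / G_ν`, continued
analytically to the upper half-plane: `V` is analytic there, in every cone `|Re z| < α Im z` one
has `F_ν(z + V(z)) = z` for `Im z` large, and `V(z) = o(z)` as `z → ∞` in the cone (which selects
the branch of the inverse). -/
def IsVoiculescuTransform (ν : Measure ℝ) (V : ℂ → ℂ) : Prop :=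
  DifferentiableOn ℂ V {z : ℂ | 0 < z.im} ∧
  ∀ α : ℝ, 0 < α →
    (∃ β : ℝ, 0 < β ∧ ∀ z : ℂ, |z.re| < α * z.im → β < z.im →
      0 < (z + V z).im ∧ (cauchyTransform ν (z + V z))⁻¹ = z) ∧
    Tendsto (fun z : ℂ => V z / z) (comap (fun z : ℂ => ‖z‖) atTop ⊓ 𝓟 {z : ℂ | |z.re| < α * z.im})
      (𝓝 0)

/-- `V_ν(it) = W(t)` for all `t > 0`. -/
def VoiculescuOnAxis (ν : Measure ℝ) (W : ℝ → ℂ) : Prop :=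
  ∃ V : ℂ → ℂ, IsVoiculescuTransform ν V ∧ ∀ t : ℝ, 0 < t → V (Complex.I * t) = W t

/-- `ν'` is the free-probability counterpart of `ν ∈ (ID, ∗)`:
`V_{ν'}(it) = i t² ∫_0^∞ log φ_ν(-u) e^{-tu} du` for `t > 0`. -/
def IsFreeCounterpart (ν ν' : Measure ℝ) : Prop :=
  ∃ ψ : ℝ → ℂ, IsLogCharFun ν ψ ∧
    VoiculescuOnAxis ν' (fun t : ℝ =>
      Complex.I * (t : ℂ) ^ 2 * ∫ u in Ioi (0 : ℝ), ψ (-u) * Complex.exp (-((t : ℂ) * u)))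

/-- The class `(𝕌_k, ⊞)` of the free counterparts of the elements of `(𝕌_k, ∗)`. -/
def FreeClassU (k : ℕ) (ν' : Measure ℝ) : Prop :=
  IsProbabilityMeasure ν' ∧ ∃ ν : Measure ℝ, ClassU k ν ∧ IsFreeCounterpart ν ν'

/-! ### The Hurwitz–Lerch function and the representation -/

/-- `f` is analytic on `ℂ ∖ [1, ∞)` and equals `∑ z^n / (v + n)^s` on the unit disc. -/
def IsHurwitzLerch (s v : ℂ) (f : ℂ → ℂ) : Prop :=
  DifferentiableOn ℂ f {z : ℂ | ¬ (z.im = 0 ∧ 1 ≤ z.re)} ∧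
    ∀ z : ℂ, ‖z‖ < 1 → HasSum (fun n : ℕ => z ^ n / (v + n) ^ s) (f z)

/-- The Hurwitz–Lerch function `Φ(z, s, v)`: the analytic continuation to `ℂ ∖ [1, ∞)` of
`∑ z^n / (v + n)^s`. -/
def hurwitzLerch (z s v : ℂ) : ℂ := Classical.epsilon (IsHurwitzLerch s v) z

/-- `k·it·Φ(x/(it), 1, k) - it - (k/(k+1))·x/(1+x²)`. -/
def kernelM (k : ℕ) (t x : ℝ) : ℂ :=
  k * (Complex.I * t) * hurwitzLerch (x / (Complex.I * t)) 1 k - Complex.I * t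
    - (k / (k + 1) : ℂ) * (x / (1 + (x : ℂ) ^ 2))

/-- `[k·it·(Φ(x/(it), 1, k) - 1/k) - (k/(k+1))·x/(1+x²)]·(1+x²)/x²`, with value
`(k/(k+2))·1/(it)` at `x = 0`. -/
def kernelm (k : ℕ) (t x : ℝ) : ℂ :=
  if x = 0 then (k / (k + 2) : ℂ) * (1 / (Complex.I * t))
  else (k * (Complex.I * t) * (hurwitzLerch (x / (Complex.I * t)) 1 k - (k : ℂ)⁻¹)
    - (k / (k + 1) : ℂ) * (x / (1 + (x : ℂ) ^ 2))) * ((1 + (x : ℂ) ^ 2) / (x : ℂ) ^ 2)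

/-- `m(dx) = x²/(1+x²) M(dx)` on `ℝ ∖ {0}` and `m({0}) = σ²`. -/
def finiteSpectralMeasure (σsq : ℝ≥0) (M : Measure ℝ) : Measure ℝ :=
  (M.restrict {0}ᶜ).withDensity (fun x => ENNReal.ofReal (x ^ 2 / (1 + x ^ 2)))
    + (σsq : ℝ≥0∞) • Measure.dirac 0

/-- `(k/(k+1)) a + (k/(k+2)) σ²/(it) + ∫_{ℝ∖{0}} kernelM dM`. -/
def transformM (k : ℕ) (a : ℝ) (σsq : ℝ≥0) (M : Measure ℝ) (t : ℝ) : ℂ :=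
  (k / (k + 1) : ℂ) * a + (k / (k + 2) : ℂ) * (((σsq : ℝ) : ℂ) / (Complex.I * t))
    + ∫ x in ({0}ᶜ : Set ℝ), kernelM k t x ∂M

/-- `(k/(k+1)) a + ∫_ℝ kernelm dm`. -/
def transformm (k : ℕ) (a : ℝ) (m : Measure ℝ) (t : ℝ) : ℂ :=
  (k / (k + 1) : ℂ) * a + ∫ x, kernelm k t x ∂m

end

/-! Everything is read off from continuous logarithms of characteristic functions. If `ψ` is that of
`μ`, independence of increments turns the Riemann–Stieltjes sums of `∫ t dY(t^k)` into sums of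
exponents, so `I_k(μ)` has logarithm `u ↦ ∫₀¹ k s^(k-1) ψ(su) ds` (`IsUIntegral.isLogCharFun`).
Insert the Lévy–Khintchine form of `ψ` and take the Laplace transform. By Fubini the variable `u`
may be integrated first, and for a jump `x` and a level `s` the result, times `i t²`, is `it/(1 -
sz) - it - s x/(1+x²)` with `z = x/(it)`. Averaging against `k s^(k-1) ds` produces the kernel of
the formula, because `∫₀¹ s^(k-1)/(1 - sz) ds = Φ(z,1,k)` (`hurwitzLerch_eq`); the drift and
Gaussian terms pick up the moments `k/(k+1)` and `k/(k+2)`. This is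
`laplace_powIntegralLog_eq_transformM`. Since the continuous logarithm is unique, (ii) follows. The
Voiculescu transform itself is never analysed: only the function prescribed on the axis is
rewritten.

For (i), laws driving a random integral and triplets must also correspond. The random integral comes
with a convolution semigroup `κ` with `κ 1 = μ`, so the Lévy–Khintchine formula is proved for
semigroups (`IsLevySemigroup.exists_hasLevyTriplet`): the measures `n (1 - sinc x) κ_{1/n}(dx)` have
convergent Fourier transforms, hence a weak limit `G`; the Lévy measure is `G/(1 - sinc)` off `0`
and the atom of `G` at `0` is the Gaussian part. Conversely, each triplet is realised by limits of
compound Poisson laws convolved with Gaussians, and the multiples of a triplet form a semigroup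
(`exists_isLevySemigroup`).

Part (iii) is a change of density; absolute convergence again comes from Fubini. -/

noncomputable section


/-! ### The Lévy–Khintchine exponent -/

/-- The integrand `e^{iux} - 1 - iux/(1+x²)` of the Lévy–Khintchine formula. -/
def levyKernel (u x : ℝ) : ℂ :=
  Complex.exp (Complex.I * u * x) - 1 - Complex.I * u * x / (1 + (x : ℂ) ^ 2)

/-- The exponent of the Lévy–Khintchine formula. -/
def levyExponent (a : ℝ) (σsq : ℝ≥0) (M : Measure ℝ) (u : ℝ) : ℂ :=
  Complex.I * u * a - (1 / 2) * ((σsq : ℝ) : ℂ) * u ^ 2 + ∫ x in ({0}ᶜ : Set ℝ), levyKernel u x ∂M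

theorem one_add_ofReal_sq (x : ℝ) : (1 + (x : ℂ) ^ 2) = ((1 + x ^ 2 : ℝ) : ℂ) := by push_cast; rfl

theorem one_add_ofReal_sq_ne_zero (x : ℝ) : (1 + (x : ℂ) ^ 2) ≠ 0 := by
  rw [one_add_ofReal_sq]; exact_mod_cast (by positivity : (1 + x ^ 2 : ℝ) ≠ 0)

theorem norm_one_add_ofReal_sq (x : ℝ) : ‖(1 + (x : ℂ) ^ 2)‖ = 1 + x ^ 2 := by
  rw [one_add_ofReal_sq, Complex.norm_real, Real.norm_of_nonneg (by positivity)]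

theorem continuous_levyKernel : Continuous fun p : ℝ × ℝ => levyKernel p.1 p.2 := by
  unfold levyKernel
  refine (by fun_prop : Continuous fun p : ℝ × ℝ => Complex.exp (Complex.I * p.1 * p.2) - 1).sub
    (Continuous.div (by fun_prop) (by fun_prop) fun p => one_add_ofReal_sq_ne_zero p.2)

theorem norm_exp_mul_I_sub_one_sub_le (y : ℝ) :
    ‖Complex.exp (Complex.I * y) - 1 - Complex.I * y‖ ≤ 2 * y ^ 2 := by
  have hn : ‖Complex.I * (y : ℂ)‖ = |y| := by simp
  rcases le_total |y| 1 with h | h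
  · refine (Complex.norm_exp_sub_one_sub_id_le (by rwa [hn])).trans ?_
    rw [hn, sq_abs]
    nlinarith [sq_nonneg y]
  · refine (norm_sub_le _ _).trans ?_
    have := Real.norm_exp_I_mul_ofReal_sub_one_le (x := y)
    rw [Real.norm_eq_abs] at this
    rw [hn]
    nlinarith [sq_abs y]

theorem norm_exp_I_mul (y : ℝ) : ‖Complex.exp (Complex.I * y)‖ = 1 := by
  rw [mul_comm, Complex.norm_exp_ofReal_mul_I]

/-- For large `x` both terms are bounded; for small `x` the compensator differs from `iux` only by
`iux · x²/(1+x²)`, so the kernel is of second order. The polynomial growth in `u` is what makes the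
later Laplace integrals converge. -/
theorem norm_levyKernel_le (u x : ℝ) :
    ‖levyKernel u x‖ ≤ (2 + |u| + 2 * u ^ 2) * min 1 (x ^ 2) := by
  have hx2 : (0 : ℝ) < 1 + x ^ 2 := by positivity
  rcases le_total 1 (x ^ 2) with h | h
  · rw [min_eq_left h]
    have e : Complex.I * u * x = Complex.I * ((u * x : ℝ) : ℂ) := by push_cast; ring
    have h1 : ‖Complex.exp (Complex.I * u * x) - 1‖ ≤ 2 := by
      refine (norm_sub_le _ _).trans ?_
      rw [e, norm_exp_I_mul]; norm_num
    have h2 : ‖Complex.I * u * x / (1 + (x : ℂ) ^ 2)‖ ≤ |u| := by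
      rw [norm_div, norm_one_add_ofReal_sq, norm_mul, norm_mul, Complex.norm_I, one_mul,
        Complex.norm_real, Complex.norm_real, Real.norm_eq_abs, Real.norm_eq_abs,
        div_le_iff₀ hx2]
      refine mul_le_mul_of_nonneg_left ?_ (abs_nonneg u)
      nlinarith [sq_abs x, sq_nonneg (|x| - 1)]
    calc _ ≤ _ := norm_sub_le _ _
      _ ≤ 2 + |u| := add_le_add h1 h2
      _ ≤ _ := by nlinarith [sq_nonneg u]
  · rw [min_eq_right h]
    have e : levyKernel u x = (Complex.exp (Complex.I * ((u * x : ℝ) : ℂ)) - 1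
        - Complex.I * ((u * x : ℝ) : ℂ))
        + Complex.I * ((u * x * (x ^ 2 / (1 + x ^ 2)) : ℝ) : ℂ) := by
      have := one_add_ofReal_sq_ne_zero x
      unfold levyKernel
      push_cast
      have e : Complex.I * u * x = Complex.I * ((u * x : ℂ)) := by ring
      rw [e]
      field_simp
      ring
    rw [e]
    refine (norm_add_le _ _).trans ?_
    have h1 := norm_exp_mul_I_sub_one_sub_le (u * x)
    have h2 : ‖Complex.I * ((u * x * (x ^ 2 / (1 + x ^ 2)) : ℝ) : ℂ)‖ ≤ |u| * x ^ 2 := by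
      rw [norm_mul, Complex.norm_I, one_mul, Complex.norm_real, Real.norm_eq_abs, abs_mul, abs_mul,
        mul_assoc]
      refine mul_le_mul_of_nonneg_left ?_ (abs_nonneg u)
      rw [abs_of_nonneg (by positivity : 0 ≤ x ^ 2 / (1 + x ^ 2)), ← mul_div_assoc,
        div_le_iff₀ hx2]
      nlinarith [sq_nonneg x, sq_abs x, sq_nonneg (|x| - 1)]
    nlinarith [sq_nonneg x, sq_nonneg u]

theorem IsLevyMeasure.integrable_min {M : Measure ℝ} (hM : IsLevyMeasure M) :
    Integrable (fun x : ℝ => min 1 (x ^ 2)) M := by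
  refine ⟨by fun_prop, ?_⟩
  rw [hasFiniteIntegral_iff_ofReal (ae_of_all _ fun x => by positivity)]
  exact hM.2

theorem IsLevyMeasure.restrict_eq {M : Measure ℝ} (hM : IsLevyMeasure M) :
    M.restrict {0}ᶜ = M := by
  refine Measure.restrict_eq_self_of_ae_mem ?_
  rw [ae_iff]
  simpa using hM.1

/-- The measure `min(1,x²) M` is finite and its density is positive off `0`, so `M` is recovered by
the inverse density. Needed for Fubini. -/
theorem IsLevyMeasure.sFinite {M : Measure ℝ} (hM : IsLevyMeasure M) : SFinite M := by
  have hf : Measurable fun x : ℝ => ENNReal.ofReal (min 1 (x ^ 2)) := by fun_prop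
  have hfin : IsFiniteMeasure (M.withDensity fun x : ℝ => ENNReal.ofReal (min 1 (x ^ 2))) :=
    isFiniteMeasure_withDensity hM.2.ne
  have h := withDensity_inv_same (μ := M) hf ?_ (ae_of_all _ fun x => ENNReal.ofReal_ne_top)
  · rw [← h]; infer_instance
  · have : ∀ᵐ x ∂M, x ≠ 0 := by rw [ae_iff]; simpa using hM.1
    filter_upwards [this] with x hx
    simp only [ne_eq, ENNReal.ofReal_eq_zero, not_le]
    positivity

theorem IsLevyMeasure.integrable_levyKernel {M : Measure ℝ} (hM : IsLevyMeasure M) (u : ℝ) :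
    Integrable (levyKernel u) M :=
  (hM.integrable_min.const_mul (2 + |u| + 2 * u ^ 2)).mono'
    (continuous_levyKernel.comp (Continuous.prodMk_right u)).aestronglyMeasurable
    (ae_of_all _ fun x => norm_levyKernel_le u x)

theorem IsLevyMeasure.continuous_integral_levyKernel {M : Measure ℝ} (hM : IsLevyMeasure M) :
    Continuous fun u => ∫ x, levyKernel u x ∂M := by
  rw [continuous_iff_continuousAt]
  intro u₀
  refine continuousAt_of_dominated (bound := fun x => (2 + (|u₀| + 1) + 2 * (|u₀| + 1) ^ 2)
      * min 1 (x ^ 2)) (.of_forall fun u => (hM.integrable_levyKernel u).1) ?_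
    (hM.integrable_min.const_mul _)
    (ae_of_all _ fun x =>
      (continuous_levyKernel.comp (Continuous.prodMk_left x)).continuousAt)
  have : ∀ᶠ u in 𝓝 u₀, |u| ≤ |u₀| + 1 :=
    ((continuous_abs.tendsto u₀).eventually_lt_const (lt_add_one _)).mono fun _ h => h.le
  filter_upwards [this] with u hu
  refine ae_of_all _ fun x => (norm_levyKernel_le u x).trans ?_
  have : u ^ 2 ≤ (|u₀| + 1) ^ 2 := by rw [← sq_abs u]; gcongr
  gcongr

theorem levyExponent_eq {M : Measure ℝ} (hM : IsLevyMeasure M) (a : ℝ) (σsq : ℝ≥0) (u : ℝ) :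
    levyExponent a σsq M u =
      Complex.I * u * a - (1 / 2) * ((σsq : ℝ) : ℂ) * u ^ 2 + ∫ x, levyKernel u x ∂M := by
  rw [levyExponent, hM.restrict_eq]

theorem IsLevyMeasure.continuous_levyExponent {M : Measure ℝ} (hM : IsLevyMeasure M) (a : ℝ)
    (σsq : ℝ≥0) : Continuous (levyExponent a σsq M) := by
  have := hM.continuous_integral_levyKernel
  rw [funext (levyExponent_eq hM a σsq)]
  fun_prop

theorem levyExponent_zero (a : ℝ) (σsq : ℝ≥0) (M : Measure ℝ) : levyExponent a σsq M 0 = 0 := by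
  simp [levyExponent, levyKernel]

theorem hasLevyTriplet_iff {μ : Measure ℝ} {a : ℝ} {σsq : ℝ≥0} {M : Measure ℝ} :
    HasLevyTriplet μ a σsq M ↔
      IsLevyMeasure M ∧ ∀ u, charFun μ u = Complex.exp (levyExponent a σsq M u) := Iff.rfl

/-! ### Lévy's continuity theorem -/

theorem tendsto_integral_charFun {μ : ℕ → Measure ℝ} {μ₀ : Measure ℝ}
    (h : ∀ f : ℝ →ᵇ ℝ, Tendsto (fun n => ∫ x, f x ∂(μ n)) atTop (𝓝 (∫ x, f x ∂μ₀)))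
    [∀ n, IsProbabilityMeasure (μ n)] [IsProbabilityMeasure μ₀] (u : ℝ) :
    Tendsto (fun n => charFun (μ n) u) atTop (𝓝 (charFun μ₀ u)) :=
  ProbabilityMeasure.tendsto_iff_tendsto_charFun.1
    ((ProbabilityMeasure.tendsto_iff_forall_integral_tendsto
      (μs := fun n => ⟨μ n, inferInstance⟩) (μ := ⟨μ₀, inferInstance⟩)).2 h) u

theorem tendsto_integral_of_tendsto_charFun {μ : ℕ → Measure ℝ} {μ₀ : Measure ℝ}
    [∀ n, IsProbabilityMeasure (μ n)] [IsProbabilityMeasure μ₀]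
    (h : ∀ u, Tendsto (fun n => charFun (μ n) u) atTop (𝓝 (charFun μ₀ u))) (f : ℝ →ᵇ ℝ) :
    Tendsto (fun n => ∫ x, f x ∂(μ n)) atTop (𝓝 (∫ x, f x ∂μ₀)) :=
  (ProbabilityMeasure.tendsto_iff_forall_integral_tendsto
      (μs := fun n => ⟨μ n, inferInstance⟩) (μ := ⟨μ₀, inferInstance⟩)).1
    (ProbabilityMeasure.tendsto_iff_tendsto_charFun.2 h) f

/-- A pointwise limit of characteristic functions which is continuous at `0` is a characteristic
function. -/
theorem exists_charFun_eq_of_tendsto {μ : ℕ → Measure ℝ} [∀ n, IsProbabilityMeasure (μ n)]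
    {φ : ℝ → ℂ} (hφ : ContinuousAt φ 0)
    (h : ∀ u, Tendsto (fun n => charFun (μ n) u) atTop (𝓝 (φ u))) :
    ∃ μ₀ : Measure ℝ, IsProbabilityMeasure μ₀ ∧ ∀ u, charFun μ₀ u = φ u := by
  -- Continuity at `0` gives tightness; Prokhorov then provides a weakly convergent subsequence,
  -- whose limit must have characteristic function `φ`.
  have ht := isTightMeasureSet_of_tendsto_charFun hφ h
  let P : ℕ → ProbabilityMeasure ℝ := fun n => ⟨μ n, inferInstance⟩
  have hc : IsCompact (closure (range P)) := by
    refine isCompact_closure_of_isTightMeasureSet ?_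
    convert ht using 1
    ext x
    exact ⟨fun ⟨_, ⟨n, rfl⟩, h⟩ => ⟨n, h⟩, fun ⟨n, h⟩ => ⟨P n, ⟨n, rfl⟩, h⟩⟩
  obtain ⟨Q, -, s, hs, hQ⟩ := hc.tendsto_subseq (x := P) fun n => subset_closure ⟨n, rfl⟩
  refine ⟨Q, inferInstance, fun u => ?_⟩
  exact tendsto_nhds_unique (ProbabilityMeasure.tendsto_iff_tendsto_charFun.1 hQ u)
    ((h u).comp hs.tendsto_atTop)


/-! ### Existence of infinitely divisible laws -/

theorem isProbabilityMeasure_convPower (ν : Measure ℝ) [IsProbabilityMeasure ν] (n : ℕ) :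
    IsProbabilityMeasure (convPower ν n) := by
  induction n with
  | zero => rw [convPower]; infer_instance
  | succ n ih => rw [convPower]; infer_instance

theorem charFun_convPower (ν : Measure ℝ) [IsProbabilityMeasure ν] (n : ℕ) (u : ℝ) :
    charFun (convPower ν n) u = charFun ν u ^ n := by
  induction n with
  | zero => simp [convPower]
  | succ n ih =>
    have := isProbabilityMeasure_convPower ν n
    rw [convPower, charFun_conv, ih, pow_succ]

theorem integrable_exp_I_mul (M : Measure ℝ) [IsFiniteMeasure M] (u : ℝ) :
    Integrable (fun x : ℝ => Complex.exp (Complex.I * u * x)) M := by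
  refine (integrable_const (1 : ℝ)).mono' (by fun_prop) (ae_of_all _ fun x => ?_)
  have e : Complex.I * u * x = Complex.I * ((u * x : ℝ) : ℂ) := by push_cast; ring
  rw [e, norm_exp_I_mul]

theorem charFun_eq_integral_exp (M : Measure ℝ) (u : ℝ) :
    charFun M u = ∫ x : ℝ, Complex.exp (Complex.I * u * x) ∂M := by
  rw [charFun_apply_real]
  congr 1 with x
  congr 1
  ring

theorem integrable_div_one_add_sq (M : Measure ℝ) [IsFiniteMeasure M] :
    Integrable (fun x : ℝ => x / (1 + x ^ 2)) M := by
  refine (integrable_const (1 : ℝ)).mono'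
    (by fun_prop : Measurable fun x : ℝ => x / (1 + x ^ 2)).aestronglyMeasurable
    (ae_of_all _ fun x => ?_)
  rw [norm_div, Real.norm_eq_abs, Real.norm_of_nonneg (by positivity),
    div_le_one (by positivity)]
  nlinarith [sq_abs x, sq_nonneg (|x| - 1)]

/-- With `l` the mass of `M`, the `n`-th convolution power of `(1 - l/n) δ₀ + M/n` has
characteristic function `(1 + (φ_M - l)/n)^n`, which tends to `exp(φ_M - l)`. -/
theorem exists_compoundPoisson (M : Measure ℝ) [IsFiniteMeasure M] :
    ∃ P : Measure ℝ, IsProbabilityMeasure P ∧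
      ∀ u : ℝ, charFun P u = Complex.exp (∫ x : ℝ, (Complex.exp (Complex.I * u * x) - 1) ∂M) := by
  let l : ℝ := M.real univ
  have hl : 0 ≤ l := measureReal_nonneg
  obtain ⟨N₀, hN₀⟩ := exists_nat_gt l
  -- The shift by `N₀ > l` keeps the weight of the Dirac mass nonnegative for every `n`.
  let p : ℕ → Measure ℝ := fun n => ENNReal.ofReal (1 - l / (n + N₀ : ℕ)) • Measure.dirac 0
    + ENNReal.ofReal (1 / (n + N₀ : ℕ)) • M
  have hpos : ∀ n : ℕ, (0 : ℝ) < (n + N₀ : ℕ) := fun n => by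
    push_cast; nlinarith [n.cast_nonneg (α := ℝ)]
  have hle : ∀ n : ℕ, 0 ≤ 1 - l / (n + N₀ : ℕ) := fun n => by
    rw [sub_nonneg, div_le_one (hpos n)]; push_cast; nlinarith [n.cast_nonneg (α := ℝ)]
  have hp : ∀ n, IsProbabilityMeasure (p n) := fun n => by
    refine ⟨?_⟩
    have hM : M univ = ENNReal.ofReal l := by simp [l]
    simp only [p, Measure.add_apply, Measure.smul_apply, measure_univ, smul_eq_mul, mul_one, hM]
    rw [← ENNReal.ofReal_mul (by have := hpos n; positivity), ← ENNReal.ofReal_add (hle n)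
      (by have := hpos n; positivity)]
    rw [← ENNReal.ofReal_one]
    congr 1
    ring
  have hint : ∀ u : ℝ, ∫ x : ℝ, (Complex.exp (Complex.I * u * x) - 1) ∂M = charFun M u - l := by
    intro u
    rw [integral_sub (integrable_exp_I_mul M u) (integrable_const _), charFun_eq_integral_exp]
    simp [l]
  have hchar : ∀ n u, charFun (p n) u = 1 + (charFun M u - l) / (n + N₀ : ℕ) := by
    intro n u
    have h1 : Integrable (fun x : ℝ => Complex.exp (Complex.I * u * x))
        (ENNReal.ofReal (1 - l / (n + N₀ : ℕ)) • Measure.dirac 0) :=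
      (integrable_exp_I_mul _ u).smul_measure ENNReal.ofReal_ne_top
    have h2 : Integrable (fun x : ℝ => Complex.exp (Complex.I * u * x))
        (ENNReal.ofReal (1 / (n + N₀ : ℕ)) • M) :=
      (integrable_exp_I_mul _ u).smul_measure ENNReal.ofReal_ne_top
    rw [charFun_eq_integral_exp, integral_add_measure h1 h2, integral_smul_measure,
      integral_smul_measure, integral_dirac, ENNReal.toReal_ofReal (hle n),
      ENNReal.toReal_ofReal (by have := hpos n; positivity), ← charFun_eq_integral_exp]
    simp only [Complex.real_smul, Complex.ofReal_zero, mul_zero, Complex.exp_zero]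
    push_cast
    ring
  have hcont : Continuous fun u => Complex.exp (charFun M u - l) := by
    have : Continuous (charFun M) := continuous_charFun
    fun_prop
  have hc := fun n => isProbabilityMeasure_convPower (p n) (n + N₀)
  have hlim : ∀ u, Tendsto (fun n => charFun (convPower (p n) (n + N₀)) u) atTop
      (𝓝 (Complex.exp (charFun M u - l))) := fun u => by
    simp only [charFun_convPower, hchar]
    exact (Complex.tendsto_one_add_div_pow_exp _).comp (tendsto_add_atTop_nat N₀)
  obtain ⟨P, hP, h⟩ := exists_charFun_eq_of_tendsto hcont.continuousAt hlim
  exact ⟨P, hP, fun u => by rw [h, hint]⟩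

/-- Cut `M` down to `|x| > 1/(n+1)`, where it is finite, take the compound Poisson law and convolve
it with a Gaussian whose mean absorbs the compensator `b n` of the truncated jumps. The exponents
converge to a continuous function, so the laws have a limit with the wanted characteristic function.
-/
theorem exists_hasLevyTriplet (a : ℝ) (σsq : ℝ≥0) {M : Measure ℝ} (hM : IsLevyMeasure M) :
    ∃ P : Measure ℝ, IsProbabilityMeasure P ∧ HasLevyTriplet P a σsq M := by
  let S : ℕ → Set ℝ := fun n => {x | 1 / ((n : ℝ) + 1) < |x|}
  have hSm : ∀ n, MeasurableSet (S n) := fun n => measurableSet_lt (by fun_prop) (by fun_prop)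
  have hSmono : Monotone S := by
    intro m n hmn x hx
    rw [mem_ofPred_eq] at hx ⊢
    refine lt_of_le_of_lt ?_ hx
    exact one_div_le_one_div_of_le (by positivity) (by simpa using hmn)
  have hSU : ⋃ n, S n = {0}ᶜ := by
    ext x
    simp only [S, mem_iUnion, mem_ofPred_eq, mem_compl_iff, mem_singleton_iff]
    refine ⟨?_, fun h => exists_nat_one_div_lt (abs_pos.2 h)⟩
    rintro ⟨n, hn⟩ rfl
    rw [abs_zero] at hn
    exact absurd hn (not_lt.2 (by positivity))
  have hfin : ∀ n, IsFiniteMeasure (M.restrict (S n)) := by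
    intro n
    refine ⟨?_⟩
    rw [Measure.restrict_apply_univ]
    have h := hM.integrable_min.measure_ge_lt_top (ε := min 1 ((1 / ((n : ℝ) + 1)) ^ 2))
      (by positivity)
    refine (measure_mono fun x hx => ?_).trans_lt h
    rw [mem_ofPred_eq] at hx ⊢
    refine min_le_min le_rfl ?_
    rw [← sq_abs x]
    gcongr
  have hdint : ∀ n, Integrable (fun x : ℝ => x / (1 + x ^ 2)) (M.restrict (S n)) :=
    fun n => integrable_div_one_add_sq _
  choose P hP hPc using fun n => exists_compoundPoisson (M.restrict (S n))
  let b : ℕ → ℝ := fun n => ∫ x in S n, x / (1 + x ^ 2) ∂M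
  have hker : ∀ n u, ∫ x in S n, levyKernel u x ∂M =
      (∫ x in S n, (Complex.exp (Complex.I * u * x) - 1) ∂M) - Complex.I * u * b n := by
    intro n u
    have e : (Complex.I * u * b n : ℂ) =
        ∫ x in S n, Complex.I * u * ((x / (1 + x ^ 2) : ℝ) : ℂ) ∂M := by
      rw [integral_const_mul, integral_complex_ofReal]
    have hd : Integrable (fun x : ℝ => Complex.I * u * ((x / (1 + x ^ 2) : ℝ) : ℂ))
        (M.restrict (S n)) := (hdint n).ofReal.const_mul _
    rw [e, ← integral_sub (f := fun x : ℝ => Complex.exp (Complex.I * u * x) - 1)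
      ((integrable_exp_I_mul _ u).sub (integrable_const _)) hd]
    congr 1 with x
    rw [levyKernel]
    push_cast
    ring
  have hlim : ∀ u, Tendsto (fun n => charFun (P n ∗ gaussianReal (a - b n) σsq) u) atTop
      (𝓝 (Complex.exp (levyExponent a σsq M u))) := fun u => by
    have hlim := tendsto_setIntegral_of_monotone hSm hSmono
      ((hM.integrable_levyKernel u).integrableOn)
    rw [hSU] at hlim
    have := (Complex.continuous_exp.tendsto _).comp (hlim.const_add
      (Complex.I * u * a - (1 / 2) * ((σsq : ℝ) : ℂ) * u ^ 2))
    refine this.congr fun n => ?_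
    rw [charFun_conv, hPc, charFun_gaussianReal, ← Complex.exp_add, Function.comp_apply, hker]
    congr 1
    push_cast
    ring
  obtain ⟨Q, hQ, h⟩ := exists_charFun_eq_of_tendsto
    (Complex.continuous_exp.comp (hM.continuous_levyExponent a σsq)).continuousAt hlim
  exact ⟨Q, hQ, hM, h⟩

theorem IsLevyMeasure.smul {M : Measure ℝ} (hM : IsLevyMeasure M) (t : ℝ≥0) :
    IsLevyMeasure (t • M) := by
  refine ⟨by simp [hM.1], ?_⟩
  rw [lintegral_smul_measure]
  exact ENNReal.mul_lt_top ENNReal.coe_lt_top hM.2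

theorem levyExponent_smul (a : ℝ) (σsq : ℝ≥0) (M : Measure ℝ) (t : ℝ≥0) (u : ℝ) :
    levyExponent (t * a) (t * σsq) (t • M) u = (t : ℝ) * levyExponent a σsq M u := by
  rw [levyExponent, levyExponent, Measure.restrict_smul, integral_smul_nnreal_measure]
  push_cast
  simp only [NNReal.smul_def, Complex.real_smul]
  ring

/-- Every triplet is that of the law at time one of a convolution semigroup. -/
theorem exists_isLevySemigroup (a : ℝ) (σsq : ℝ≥0) {M : Measure ℝ} (hM : IsLevyMeasure M) :
    ∃ κ : ℝ≥0 → Measure ℝ, IsLevySemigroup κ ∧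
      ∀ t u, charFun (κ t) u = Complex.exp ((t : ℝ) * levyExponent a σsq M u) := by
  choose κ hκ hκt using fun t : ℝ≥0 => exists_hasLevyTriplet (t * a) (t * σsq) (hM.smul t)
  have hchar : ∀ t u, charFun (κ t) u = Complex.exp ((t : ℝ) * levyExponent a σsq M u) :=
    fun t u => by rw [← levyExponent_smul]; exact (hκt t).2 u
  refine ⟨κ, ⟨hκ, ?_, fun s t => ?_, fun f => ?_⟩, hchar⟩
  · refine Measure.ext_of_charFun (funext fun u => ?_)
    rw [hchar, charFun_dirac]
    simp
  · refine Measure.ext_of_charFun (funext fun u => ?_)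
    rw [charFun_conv, hchar, hchar, hchar, ← Complex.exp_add]
    push_cast
    ring_nf
  · refine tendsto_of_seq_tendsto fun s hs => ?_
    have h := tendsto_integral_of_tendsto_charFun (μ := fun n => κ (s n))
      (μ₀ := Measure.dirac 0) (fun u => ?_) f
    · simpa [Function.comp_def] using h
    · simp only [hchar, charFun_dirac]
      have hs' : Tendsto (fun n => ((s n : ℝ) : ℂ)) atTop (𝓝 0) := by
        have : Continuous fun x : ℝ≥0 => ((x : ℝ) : ℂ) := by fun_prop
        simpa [Function.comp_def] using (this.tendsto 0).comp hs
      have := (Complex.continuous_exp.tendsto _).comp (hs'.mul_const (levyExponent a σsq M u))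
      simpa [Function.comp_def] using this

theorem IsLevySemigroup.convPower_eq {κ : ℝ≥0 → Measure ℝ} (hκ : IsLevySemigroup κ) (t : ℝ≥0)
    (n : ℕ) : convPower (κ t) n = κ (n * t) := by
  induction n with
  | zero => simp [convPower, hκ.zero]
  | succ n ih => rw [convPower, ih, ← hκ.add]; congr 1; push_cast; ring

theorem IsLevySemigroup.isInfinitelyDivisible {κ : ℝ≥0 → Measure ℝ} (hκ : IsLevySemigroup κ)
    (t : ℝ≥0) : IsInfinitelyDivisible (κ t) := by
  refine ⟨hκ.prob t, fun n hn => ⟨κ (t / n), hκ.prob _, ?_⟩⟩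
  rw [hκ.convPower_eq, mul_div_cancel₀]
  exact_mod_cast (by omega : n ≠ 0)


/-! ### The Lévy–Khintchine kernel relative to `1 - sinc` -/

theorem abs_one_sub_sinc_sub_le {x : ℝ} (hx : |x| ≤ 1) :
    |1 - Real.sinc x - x ^ 2 / 6| ≤ x ^ 4 / 100 := by
  rcases eq_or_ne x 0 with rfl | h0
  · simp
  have hb := Real.sin_bound hx
  have h0' : 0 < |x| := abs_pos.2 h0
  have e : 1 - Real.sinc x - x ^ 2 / 6 = -(Real.sin x - (x - x ^ 3 / 6)) / x := by
    rw [Real.sinc_of_ne_zero h0]; field_simp; ring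
  rw [e, abs_div, abs_neg, div_le_iff₀ h0']
  refine hb.trans_eq ?_
  rw [← (by decide : Even 4).pow_abs x]
  ring

theorem sq_le_one_sub_sinc {x : ℝ} (hx : |x| ≤ 1) : x ^ 2 / 10 ≤ 1 - Real.sinc x := by
  have h := (abs_le.1 (abs_one_sub_sinc_sub_le hx)).1
  have hx2 : x ^ 2 ≤ 1 := by rw [← sq_abs]; exact pow_le_one₀ (abs_nonneg x) hx
  nlinarith [sq_nonneg x]

/-- Dividing a finite measure by `1 - sinc` thus keeps `min(1,x²)` integrable. The constant is
dictated by `1 ≤ x ≤ 2`, where `1 - sinc x ≥ 1 - sinc (x/2) ≥ x²/40 ≥ 1/40`. -/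
theorem min_le_one_sub_sinc (x : ℝ) : min 1 (x ^ 2) ≤ 40 * (1 - Real.sinc x) := by
  wlog hx : 0 ≤ x generalizing x
  · have := this (-x) (by linarith)
    simpa using this
  rcases le_total x 1 with h1 | h1
  · have := sq_le_one_sub_sinc (x := x) (by rwa [abs_of_nonneg hx])
    have := min_le_right 1 (x ^ 2)
    nlinarith [sq_nonneg x]
  have h0 : x ≠ 0 := by linarith
  refine (min_le_left _ _).trans ?_
  rcases le_total x 2 with h2 | h2
  · have hs : Real.sinc x ≤ Real.sinc (x / 2) := by
      rw [Real.sinc_of_ne_zero h0, Real.sinc_of_ne_zero (by positivity),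
        div_le_div_iff₀ (by linarith) (by linarith)]
      have hsin : Real.sin x = 2 * Real.sin (x / 2) * Real.cos (x / 2) := by
        rw [← Real.sin_two_mul]; ring_nf
      have hp : 0 ≤ Real.sin (x / 2) :=
        Real.sin_nonneg_of_nonneg_of_le_pi (by linarith) (by linarith [Real.pi_gt_three])
      rw [hsin]
      nlinarith [mul_nonneg hp (sub_nonneg.2 (Real.cos_le_one (x / 2))), mul_nonneg
        (mul_nonneg hp (sub_nonneg.2 (Real.cos_le_one (x / 2)))) hx]
    have := sq_le_one_sub_sinc (x := x / 2) (by rw [abs_of_nonneg] <;> linarith)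
    nlinarith
  · have := Real.sinc_le_inv_abs h0
    rw [abs_of_nonneg hx] at this
    have h3 : x⁻¹ ≤ 2⁻¹ := inv_anti₀ (by norm_num) h2
    norm_num at h3
    linarith

theorem one_sub_sinc_pos {x : ℝ} (hx : x ≠ 0) : 0 < 1 - Real.sinc x := by
  have h := min_le_one_sub_sinc x
  have : 0 < min 1 (x ^ 2) := by positivity
  linarith

/-- Taylor expansion to third order; it identifies the limit of `levyKernel u x / x²` at `0` as
`-u²/2`. -/
theorem norm_levyKernel_add_le {u x : ℝ} (h : |u * x| ≤ 1) :
    ‖levyKernel u x + u ^ 2 * x ^ 2 / 2‖ ≤ (|u| ^ 3 + |u|) * |x| ^ 3 := by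
  have hn : ‖Complex.I * ((u * x : ℝ) : ℂ)‖ = |u * x| := by
    rw [norm_mul, Complex.norm_I, one_mul, Complex.norm_real, Real.norm_eq_abs]
  have h1 := Complex.exp_bound (x := Complex.I * ((u * x : ℝ) : ℂ)) (by rwa [hn])
    (n := 3) (by norm_num)
  have e : levyKernel u x + u ^ 2 * x ^ 2 / 2 = (Complex.exp (Complex.I * ((u * x : ℝ) : ℂ)) -
      ∑ m ∈ Finset.range 3, (Complex.I * ((u * x : ℝ) : ℂ)) ^ m / m.factorial)
      + Complex.I * ((u * x * (x ^ 2 / (1 + x ^ 2)) : ℝ) : ℂ) := by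
    have := one_add_ofReal_sq_ne_zero x
    unfold levyKernel
    simp only [Finset.sum_range_succ, Finset.sum_range_zero, mul_pow, Complex.I_sq]
    push_cast [Nat.factorial]
    have e : Complex.I * u * x = Complex.I * ((u * x : ℂ)) := by ring
    rw [e]
    field_simp
    ring
  have h2 : ‖Complex.I * ((u * x * (x ^ 2 / (1 + x ^ 2)) : ℝ) : ℂ)‖ ≤ |u| * |x| ^ 3 := by
    rw [norm_mul, Complex.norm_I, one_mul, Complex.norm_real, Real.norm_eq_abs, abs_mul, abs_mul,
      mul_assoc]
    refine mul_le_mul_of_nonneg_left ?_ (abs_nonneg u)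
    rw [abs_of_nonneg (by positivity : 0 ≤ x ^ 2 / (1 + x ^ 2)), pow_succ' |x|, sq_abs]
    refine mul_le_mul_of_nonneg_left (div_le_self (sq_nonneg x) ?_) (abs_nonneg x)
    nlinarith [sq_nonneg x]
  rw [e]
  refine (norm_add_le _ _).trans ?_
  rw [hn, abs_mul, mul_pow] at h1
  have h3 : |u| ^ 3 * |x| ^ 3 * (((3 : ℕ).succ : ℝ) * (((3 : ℕ).factorial : ℝ) * (3 : ℕ))⁻¹) ≤
      |u| ^ 3 * |x| ^ 3 := by
    refine mul_le_of_le_one_right (by positivity) ?_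
    norm_num [Nat.factorial]
  linarith

/-- The quotient of the Lévy–Khintchine kernel by `1 - sinc`, extended continuously to `0`. -/
def sincKernel (u x : ℝ) : ℂ :=
  if x = 0 then -(3 * u ^ 2 : ℂ) else levyKernel u x / ((1 - Real.sinc x : ℝ) : ℂ)

theorem levyKernel_zero_right (u : ℝ) : levyKernel u 0 = 0 := by simp [levyKernel]

theorem smul_sincKernel (u x : ℝ) : (1 - Real.sinc x) • sincKernel u x = levyKernel u x := by
  rcases eq_or_ne x 0 with rfl | hx
  · simp [levyKernel_zero_right]
  · have : ((1 - Real.sinc x : ℝ) : ℂ) ≠ 0 := by exact_mod_cast (one_sub_sinc_pos hx).ne'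
    rw [sincKernel, if_neg hx, Complex.real_smul, mul_div_cancel₀ _ this]

/-- At `0` the numerator behaves like `-u²x²/2` and the denominator like `x²/6`, so the quotient
tends to `-3u²`. Continuity and boundedness allow weak limits to be taken against this kernel. -/
theorem continuous_sincKernel (u : ℝ) : Continuous (sincKernel u) := by
  have hl : Continuous (levyKernel u) := continuous_levyKernel.comp (Continuous.prodMk_right u)
  rw [continuous_iff_continuousAt]
  intro x
  rcases eq_or_ne x 0 with rfl | hx
  · rw [continuousAt_iff_punctured_nhds]
    have h1 : Tendsto (fun x : ℝ => levyKernel u x / (x : ℂ) ^ 2) (𝓝[≠] 0) (𝓝 (-(u ^ 2 / 2))) := by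
      rw [tendsto_iff_norm_sub_tendsto_zero]
      have hz : Tendsto (fun x : ℝ => (|u| ^ 3 + |u|) * |x|) (𝓝[≠] 0) (𝓝 0) := by
        have : Continuous fun x : ℝ => (|u| ^ 3 + |u|) * |x| := by fun_prop
        simpa using (this.tendsto 0).mono_left nhdsWithin_le_nhds
      refine squeeze_zero' (.of_forall fun _ => norm_nonneg _) ?_ hz
      have hs : ∀ᶠ x in 𝓝[≠] (0 : ℝ), |u * x| < 1 := by
        have : Continuous fun x : ℝ => |u * x| := by fun_prop
        refine ((this.tendsto 0).mono_left nhdsWithin_le_nhds).eventually_lt_const ?_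
        simp
      filter_upwards [hs, self_mem_nhdsWithin] with x hx hx0
      have hx0 : x ≠ 0 := hx0
      have hxc : (x : ℂ) ≠ 0 := by exact_mod_cast hx0
      have e : levyKernel u x / (x : ℂ) ^ 2 - -(u ^ 2 / 2) =
          (levyKernel u x + u ^ 2 * x ^ 2 / 2) / (x : ℂ) ^ 2 := by field_simp; ring
      rw [e, norm_div, norm_pow, Complex.norm_real, Real.norm_eq_abs, div_le_iff₀ (by positivity)]
      refine (norm_levyKernel_add_le hx.le).trans_eq ?_
      ring
    have h2 : Tendsto (fun x : ℝ => (1 - Real.sinc x) / x ^ 2) (𝓝[≠] 0) (𝓝 (1 / 6)) := by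
      rw [tendsto_iff_norm_sub_tendsto_zero]
      have hz : Tendsto (fun x : ℝ => x ^ 2 / 100) (𝓝[≠] 0) (𝓝 0) := by
        have : Continuous fun x : ℝ => x ^ 2 / 100 := by fun_prop
        simpa using (this.tendsto 0).mono_left nhdsWithin_le_nhds
      refine squeeze_zero' (.of_forall fun _ => norm_nonneg _) ?_ hz
      have hs : ∀ᶠ x in 𝓝[≠] (0 : ℝ), |x| < 1 := by
        refine ((continuous_abs.tendsto 0).mono_left nhdsWithin_le_nhds).eventually_lt_const ?_
        simp
      filter_upwards [hs, self_mem_nhdsWithin] with x hx hx0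
      have hx0 : x ≠ 0 := hx0
      have e : (1 - Real.sinc x) / x ^ 2 - 1 / 6 = (1 - Real.sinc x - x ^ 2 / 6) / x ^ 2 := by
        field_simp
      rw [e, Real.norm_eq_abs, abs_div, abs_of_nonneg (sq_nonneg x), div_le_iff₀ (by positivity)]
      refine (abs_one_sub_sinc_sub_le hx.le).trans_eq ?_
      ring
    have h2' : Tendsto (fun x : ℝ => (((1 - Real.sinc x) / x ^ 2 : ℝ) : ℂ)) (𝓝[≠] 0)
        (𝓝 ((1 / 6 : ℝ) : ℂ)) := (Complex.continuous_ofReal.tendsto _).comp h2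
    have h3 := h1.div h2' (by norm_num)
    have e0 : sincKernel u 0 = -(u ^ 2 / 2) / ((1 / 6 : ℝ) : ℂ) := by
      simp [sincKernel]; ring
    rw [e0]
    refine h3.congr' ?_
    filter_upwards [self_mem_nhdsWithin] with x hx0
    have hx0 : x ≠ 0 := hx0
    have hxc : (x : ℂ) ≠ 0 := by exact_mod_cast hx0
    have : ((1 - Real.sinc x : ℝ) : ℂ) ≠ 0 := by exact_mod_cast (one_sub_sinc_pos hx0).ne'
    rw [sincKernel, if_neg hx0, Pi.div_apply, Complex.ofReal_div, Complex.ofReal_pow]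
    field_simp
  · have h : ContinuousAt (fun x => levyKernel u x / ((1 - Real.sinc x : ℝ) : ℂ)) x := by
      refine hl.continuousAt.div ?_ ?_
      · have := Real.continuous_sinc; fun_prop
      · exact_mod_cast (one_sub_sinc_pos hx).ne'
    refine h.congr ?_
    filter_upwards [isOpen_ne.mem_nhds hx] with y hy
    rw [sincKernel, if_neg hy]

theorem norm_sincKernel_le (u x : ℝ) :
    ‖sincKernel u x‖ ≤ 40 * (2 + |u| + 2 * u ^ 2) := by
  rcases eq_or_ne x 0 with rfl | hx
  · rw [sincKernel, if_pos rfl, norm_neg, norm_mul, norm_pow, Complex.norm_real]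
    simp only [Complex.norm_ofNat, Real.norm_eq_abs, sq_abs]
    nlinarith [abs_nonneg u, sq_nonneg u]
  · have hp := one_sub_sinc_pos hx
    rw [sincKernel, if_neg hx, norm_div, Complex.norm_real, Real.norm_of_nonneg hp.le,
      div_le_iff₀ hp]
    have := norm_levyKernel_le u x
    have h2 := min_le_one_sub_sinc x
    have h3 : 0 ≤ 2 + |u| + 2 * u ^ 2 := by positivity
    nlinarith [mul_le_mul_of_nonneg_left h2 h3]

/-- `sincKernel u` as a bounded continuous function. -/
def sincKernelBCF (u : ℝ) : ℝ →ᵇ ℂ :=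
  BoundedContinuousFunction.ofNormedAddCommGroup (sincKernel u) (continuous_sincKernel u)
    (40 * (2 + |u| + 2 * u ^ 2)) (norm_sincKernel_le u)

/-- The mean of `e^{isx}` over `s ∈ [-1,1]` is `sinc x`. Hence subtracting from a characteristic
function its moving average amounts to giving the measure the density `1 - sinc`. -/
theorem integral_charFun_add (μ : Measure ℝ) [IsFiniteMeasure μ] (u : ℝ) :
    ∫ s in (-1 : ℝ)..1, charFun μ (u + s) =
      2 * ∫ x : ℝ, Complex.exp (Complex.I * u * x) * (Real.sinc x : ℂ) ∂μ := by
  have hint : Integrable (Function.uncurry fun s x : ℝ =>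
      Complex.exp (Complex.I * ((u + s : ℝ) : ℂ) * x))
      ((volume.restrict (uIoc (-1 : ℝ) 1)).prod μ) := by
    have : IsFiniteMeasure (volume.restrict (uIoc (-1 : ℝ) 1)) := by
      rw [uIoc_of_le (by norm_num)]; infer_instance
    refine (integrable_const (1 : ℝ)).mono' (Continuous.aestronglyMeasurable (by
      unfold Function.uncurry; fun_prop)) (ae_of_all _ fun p => ?_)
    have e : Complex.I * ((u + p.1 : ℝ) : ℂ) * p.2 = Complex.I * (((u + p.1) * p.2 : ℝ) : ℂ) := by
      push_cast; ring
    rw [Function.uncurry, e, norm_exp_I_mul]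
  simp_rw [charFun_eq_integral_exp]
  rw [intervalIntegral_integral_swap hint, ← integral_const_mul]
  congr 1 with x
  have h := integral_charFun_Icc (μ := Measure.dirac x) (r := 1) one_pos
  simp only [charFun_dirac, integral_dirac, one_mul] at h
  have e : ∀ s : ℝ, Complex.exp (Complex.I * ((u + s : ℝ) : ℂ) * x) =
      Complex.exp (Complex.I * u * x) * Complex.exp ((inner ℝ x s : ℝ) * Complex.I) := by
    intro s
    rw [← Complex.exp_add]
    congr 1
    simp
    ring
  simp_rw [e]
  rw [intervalIntegral.integral_const_mul, h]
  push_cast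
  ring

/-! ### Weak limits of finite measures -/

/-- Finite measures whose Fourier transforms converge pointwise to a function which is continuous
at `0` converge weakly to a finite measure. -/
theorem exists_tendsto_integral_of_tendsto_charFun {H : ℕ → Measure ℝ}
    [hH : ∀ n, IsFiniteMeasure (H n)] {h : ℝ → ℂ} (hc : ContinuousAt h 0)
    (hlim : ∀ u, Tendsto (fun n => charFun (H n) u) atTop (𝓝 (h u))) :
    ∃ G : Measure ℝ, IsFiniteMeasure G ∧
      ∀ f : ℝ →ᵇ ℂ, Tendsto (fun n => ∫ x, f x ∂(H n)) atTop (𝓝 (∫ x, f x ∂G)) := by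
  have hmass : Tendsto (fun n => (((H n).real univ : ℝ) : ℂ)) atTop (𝓝 (h 0)) := by
    refine (hlim 0).congr fun n => charFun_zero _
  let m : ℝ := (h 0).re
  have hm : Tendsto (fun n => (H n).real univ) atTop (𝓝 m) := by
    have := (Complex.continuous_re.tendsto _).comp hmass
    simpa [Function.comp_def] using this
  have hm' : h 0 = m := tendsto_nhds_unique hmass ((Complex.continuous_ofReal.tendsto _).comp hm)
  let F : ℕ → FiniteMeasure ℝ := fun n => ⟨H n, hH n⟩
  have hF : ∀ n (f : ℝ → ℂ), ∫ x, f x ∂(H n) =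
      (H n).real univ * ∫ x, f x ∂((F n).normalize : Measure ℝ) := by
    intro n f
    have e : H n = (F n).mass • ((F n).normalize : Measure ℝ) :=
      congrArg FiniteMeasure.toMeasure (F n).self_eq_mass_smul_normalize
    have e2 : ((F n).mass : ℝ) = (H n).real univ := rfl
    conv_lhs => rw [e]
    rw [integral_smul_nnreal_measure, NNReal.smul_def, e2, Complex.real_smul]
  have hm0 : 0 ≤ m := ge_of_tendsto' hm fun n => measureReal_nonneg
  -- If the masses tend to `0` the weak limit is the zero measure; otherwise the measures are
  -- normalised and the continuity theorem for probability measures applies.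
  rcases hm0.eq_or_lt with hz | hpos
  · refine ⟨0, inferInstance, fun f => ?_⟩
    rw [integral_zero_measure]
    refine squeeze_zero_norm (a := fun n => (H n).real univ * ‖f‖) (fun n => ?_) ?_
    · rw [mul_comm]
      exact norm_integral_le_of_norm_le_const (ae_of_all _ f.norm_coe_le_norm)
    · rw [← hz] at hm
      simpa using hm.mul_const ‖f‖
  · have hmc : (m : ℂ) ≠ 0 := by exact_mod_cast hpos.ne'
    have hn : ∀ u, Tendsto (fun n => charFun ((F n).normalize : Measure ℝ) u) atTop
        (𝓝 (h u / m)) := by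
      intro u
      have := (hlim u).div (hm' ▸ hmass) hmc
      refine this.congr' ?_
      filter_upwards [hm.eventually_ne hpos.ne'] with n hn
      have hn' : (((H n).real univ : ℝ) : ℂ) ≠ 0 := by exact_mod_cast hn
      rw [Pi.div_apply, charFun_eq_integral_exp, hF, mul_div_cancel_left₀ _ hn',
        ← charFun_eq_integral_exp]
    obtain ⟨P, hP, hPc⟩ := exists_charFun_eq_of_tendsto (hc.div_const _) hn
    have hw : Tendsto (fun n => (F n).normalize) atTop (𝓝 (⟨P, hP⟩ : ProbabilityMeasure ℝ)) :=
      ProbabilityMeasure.tendsto_iff_tendsto_charFun.2 fun u => by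
        have := hn u
        rw [← hPc] at this
        exact this
    refine ⟨m.toNNReal • P, inferInstance, fun f => ?_⟩
    have := hmass.mul ((ProbabilityMeasure.tendsto_iff_forall_integral_rclike_tendsto ℂ).1 hw f)
    rw [integral_smul_nnreal_measure, NNReal.smul_def, Real.coe_toNNReal _ hm0, Complex.real_smul,
      ← hm']
    refine this.congr fun n => (hF n f).symm


/-! ### The logarithm of the characteristic functions of a convolution semigroup -/

/-- For `|u| ≤ U` one has `|e^{iux} - 1| ≤ min(2, |U||x|)`, a bounded continuous function vanishing
at `0`; weak continuity of `κ` at time `0` then gives a bound uniform in `u`. -/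
theorem IsLevySemigroup.eventually_norm_charFun_sub_one_lt {κ : ℝ≥0 → Measure ℝ}
    (hκ : IsLevySemigroup κ) (U : ℝ) :
    ∀ᶠ t in 𝓝 (0 : ℝ≥0), ∀ u, |u| ≤ U → ‖charFun (κ t) u - 1‖ < 1 := by
  let f : ℝ →ᵇ ℝ := BoundedContinuousFunction.ofNormedAddCommGroup (fun x => min 2 (|U| * |x|))
    (by fun_prop) 2 fun x => by
      rw [Real.norm_of_nonneg (by positivity)]; exact min_le_left _ _
  have h := hκ.cont f
  have hf0 : f 0 = 0 := by simp [f]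
  rw [hf0] at h
  filter_upwards [h.eventually_lt_const one_pos] with t ht u hu
  have := hκ.prob t
  have e : charFun (κ t) u - 1 = ∫ x : ℝ, (Complex.exp (Complex.I * u * x) - 1) ∂(κ t) := by
    rw [integral_sub (integrable_exp_I_mul _ u) (integrable_const _), charFun_eq_integral_exp]
    simp
  rw [e]
  refine (norm_integral_le_of_norm_le (f.integrable _) (ae_of_all _ fun x => ?_)).trans_lt ht
  have ex : Complex.I * u * x = Complex.I * ((u * x : ℝ) : ℂ) := by push_cast; ring
  rw [ex]
  refine le_min ?_ ?_
  · refine (norm_sub_le _ _).trans ?_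
    rw [norm_exp_I_mul]; norm_num
  · refine Real.norm_exp_I_mul_ofReal_sub_one_le.trans ?_
    rw [Real.norm_eq_abs, abs_mul]
    have := hu.trans (le_abs_self U)
    gcongr

theorem IsLevySemigroup.charFun_add {κ : ℝ≥0 → Measure ℝ} (hκ : IsLevySemigroup κ) (s t : ℝ≥0)
    (u : ℝ) : charFun (κ (s + t)) u = charFun (κ s) u * charFun (κ t) u := by
  have := hκ.prob s
  have := hκ.prob t
  rw [hκ.add, charFun_conv]

theorem IsLevySemigroup.charFun_nsmul {κ : ℝ≥0 → Measure ℝ} (hκ : IsLevySemigroup κ) (t : ℝ≥0)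
    (n : ℕ) (u : ℝ) : charFun (κ (n * t)) u = charFun (κ t) u ^ n := by
  have := hκ.prob t
  rw [← hκ.convPower_eq, charFun_convPower]

/-- Both points lie in the right half-plane, so their arguments add up without leaving `(-π, π)`. -/
theorem Complex.log_mul_of_norm_sub_one_lt {z w : ℂ} (hz : ‖z - 1‖ < 1) (hw : ‖w - 1‖ < 1) :
    Complex.log (z * w) = Complex.log z + Complex.log w := by
  have key : ∀ {z : ℂ}, ‖z - 1‖ < 1 → z ≠ 0 ∧ |z.arg| < Real.pi / 2 := by
    intro z hz
    have hre : 0 < z.re := by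
      have := (Complex.abs_re_le_norm (z - 1)).trans_lt hz
      rw [Complex.sub_re, Complex.one_re, abs_lt] at this
      linarith
    refine ⟨fun h => ?_, Complex.abs_arg_lt_pi_div_two_iff.2 (Or.inl hre)⟩
    rw [h] at hre
    simp at hre
  obtain ⟨hz0, hza⟩ := key hz
  obtain ⟨hw0, hwa⟩ := key hw
  rw [abs_lt] at hza hwa
  exact Complex.log_mul hz0 hw0 ⟨by linarith, by linarith⟩

theorem IsLevySemigroup.log_charFun_nsmul {κ : ℝ≥0 → Measure ℝ} (hκ : IsLevySemigroup κ) {u : ℝ}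
    {t : ℝ≥0} (n : ℕ) (h : ∀ s ≤ n * t, ‖charFun (κ s) u - 1‖ < 1) :
    Complex.log (charFun (κ (n * t)) u) = n * Complex.log (charFun (κ t) u) := by
  induction n with
  | zero => simp [hκ.zero]
  | succ n ih =>
    have hle : (n : ℝ≥0) * t ≤ (n + 1 : ℕ) * t := by push_cast; gcongr; simp
    have hle' : t ≤ (n + 1 : ℕ) * t := by push_cast; rw [add_mul, one_mul]; exact le_add_self
    have e : ((n + 1 : ℕ) : ℝ≥0) * t = n * t + t := by push_cast; ring
    have h1 := ih fun s hs => h s (hs.trans hle)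
    rw [e, hκ.charFun_add, Complex.log_mul_of_norm_sub_one_lt (h _ hle) (h _ hle'), h1]
    push_cast
    ring

/-- The continuous logarithm of `κ 1`, which is locally uniformly `n log φ_{κ (1 / n)}` for large
`n`. -/
theorem IsLevySemigroup.exists_log {κ : ℝ≥0 → Measure ℝ} (hκ : IsLevySemigroup κ) :
    ∃ ψ : ℝ → ℂ, IsLogCharFun (κ 1) ψ ∧ ∀ U : ℝ, ∀ᶠ n : ℕ in atTop, ∀ u, |u| ≤ U →
      charFun (κ (1 / n)) u = Complex.exp (ψ u / n) := by
  have hN : ∀ U : ℝ, ∃ N : ℕ, 0 < N ∧ ∀ n : ℕ, N ≤ n → ∀ s ≤ 1 / (n : ℝ≥0), ∀ u, |u| ≤ U →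
      ‖charFun (κ s) u - 1‖ < 1 := by
    intro U
    obtain ⟨δ, hδ, h⟩ := (nhds_bot_basis (α := ℝ≥0)).eventually_iff.1
      (hκ.eventually_norm_charFun_sub_one_lt U)
    obtain ⟨N, hN⟩ := exists_nat_gt (1 / δ)
    have hN0 : 0 < N := by
      rw [← Nat.cast_pos (α := ℝ≥0)]; exact lt_of_le_of_lt zero_le hN
    refine ⟨N, hN0, fun n hn s hs => h (lt_of_le_of_lt hs ?_)⟩
    have hn' : (N : ℝ≥0) ≤ n := by exact_mod_cast hn
    have hδ' : 0 < δ := hδ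
    rw [div_lt_iff₀ (lt_of_lt_of_le (by exact_mod_cast hN0) hn')]
    rw [div_lt_iff₀ hδ', mul_comm] at hN
    exact hN.trans_le (by gcongr)
  choose N hN0 hN using hN
  let L : ℕ → ℝ → ℂ := fun n u => n * Complex.log (charFun (κ (1 / n)) u)
  -- Up to time `1/n` the characteristic functions stay in the unit disc about `1`, so the principal
  -- logarithm is additive there. Comparing `n` and `n'` through `n * n'` then shows that `L n u`
  -- does not depend on `n` once `n` is large.
  have hmul : ∀ U : ℝ, ∀ n, N U ≤ n → ∀ m : ℕ, 0 < m → ∀ u, |u| ≤ U → L (m * n) u = L n u := by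
    intro U n hn m hm u hu
    have hm' : (m : ℝ≥0) ≠ 0 := by exact_mod_cast hm.ne'
    have e : (1 / n : ℝ≥0) = m * (1 / ((m * n : ℕ) : ℝ≥0)) := by
      push_cast
      rw [mul_one_div, ← div_div, div_self hm']
    have := hκ.log_charFun_nsmul (u := u) (t := 1 / ((m * n : ℕ) : ℝ≥0)) m
      (by rw [← e]; exact fun s hs => hN U n hn s hs u hu)
    simp only [L]
    rw [e, this]
    push_cast
    ring
  have heq : ∀ U U' : ℝ, ∀ n n', N U ≤ n → N U' ≤ n' → ∀ u, |u| ≤ U → |u| ≤ U' →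
      L n u = L n' u := by
    intro U U' n n' hn hn' u hu hu'
    rw [← hmul U n hn n' ((hN0 U').trans_le hn') u hu,
      ← hmul U' n' hn' n ((hN0 U).trans_le hn) u hu', mul_comm]
  have hexp : ∀ U : ℝ, ∀ n, N U ≤ n → ∀ u, |u| ≤ U →
      charFun (κ (1 / n)) u = Complex.exp (L n u / n) := by
    intro U n hn u hu
    have h1 := hN U n hn _ le_rfl u hu
    have hn0 : (n : ℂ) ≠ 0 := by exact_mod_cast ((hN0 U).trans_le hn).ne'
    have hne : charFun (κ (1 / n)) u ≠ 0 := by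
      intro h; rw [h] at h1; simp at h1
    simp only [L]
    rw [mul_div_cancel_left₀ _ hn0, Complex.exp_log hne]
  let ψ : ℝ → ℂ := fun u => L (N (|u| + 1)) u
  have hψ : ∀ U n, N U ≤ n → ∀ u, |u| ≤ U → ψ u = L n u := fun U n hn u hu =>
    heq _ U _ n le_rfl hn u (by linarith) hu
  refine ⟨ψ, ⟨?_, ?_, fun u => ?_⟩, fun U => ?_⟩
  · rw [continuous_iff_continuousAt]
    intro u
    have hU : ∀ᶠ v in 𝓝 u, |v| ≤ |u| + 1 :=
      ((continuous_abs.tendsto u).eventually_lt_const (lt_add_one _)).mono fun _ h => h.le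
    -- The index in `ψ` varies with the point, but near `u` it may be frozen, since `hψ` makes the
    -- value independent of it.
    refine ContinuousAt.congr ?_ (f := L (N (|u| + 1)))
      (hU.mono fun v hv => (hψ _ _ le_rfl v hv).symm)
    have := hκ.prob (1 / (N (|u| + 1) : ℝ≥0))
    have hc : Continuous (charFun (κ (1 / (N (|u| + 1) : ℝ≥0)))) := continuous_charFun
    refine continuousAt_const.mul (hc.continuousAt.clog ?_)
    have h1 := hN _ _ le_rfl _ le_rfl u (show |u| ≤ |u| + 1 by linarith)
    have := (Complex.abs_re_le_norm _).trans_lt h1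
    rw [Complex.sub_re, Complex.one_re, abs_lt] at this
    exact Or.inl (by linarith)
  · have := hκ.prob (1 / (N (|(0 : ℝ)| + 1) : ℝ≥0))
    simp only [ψ, L]
    rw [charFun_zero, probReal_univ]
    simp
  · have hu : |u| ≤ |u| + 1 := by linarith
    have hn0 : (N (|u| + 1) : ℂ) ≠ 0 := by exact_mod_cast (hN0 _).ne'
    have hn0' : (N (|u| + 1) : ℝ≥0) ≠ 0 := by exact_mod_cast (hN0 _).ne'
    have h1 := hκ.charFun_nsmul (1 / (N (|u| + 1) : ℝ≥0)) (N (|u| + 1)) u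
    rw [mul_one_div, div_self hn0', hexp _ _ le_rfl u hu, ← Complex.exp_nat_mul,
      mul_div_cancel₀ _ hn0] at h1
    exact h1.symm
  · filter_upwards [eventually_ge_atTop (N U)] with n hn u hu
    rw [hexp U n hn u hu, hψ U n hn u hu]


/-! ### The Lévy–Khintchine formula -/

theorem tendsto_nat_mul_exp_div_sub_one (z : ℂ) :
    Tendsto (fun n : ℕ => (n : ℂ) * (Complex.exp (z / n) - 1)) atTop (𝓝 z) := by
  have h : HasDerivAt (fun w : ℂ => Complex.exp (z * w)) z 0 := by
    have := ((hasDerivAt_id (0 : ℂ)).const_mul z).cexp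
    simpa using this
  have h2 := h.tendsto_slope_zero
  have h3 : Tendsto (fun n : ℕ => ((n : ℂ))⁻¹) atTop (𝓝[≠] 0) := by
    refine tendsto_nhdsWithin_iff.2 ⟨tendsto_inv_atTop_nhds_zero_nat, ?_⟩
    filter_upwards [eventually_gt_atTop 0] with n hn
    simpa using hn.ne'
  refine (h2.comp h3).congr fun n => ?_
  simp [div_eq_mul_inv]

/-- Dividing a finite measure by `1 - sinc` yields a Lévy measure. -/
theorem isLevyMeasure_withDensity_inv (G : Measure ℝ) [IsFiniteMeasure G] :
    IsLevyMeasure ((G.restrict {0}ᶜ).withDensity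
      fun x => ENNReal.ofReal (1 - Real.sinc x)⁻¹) := by
  have hs := Real.continuous_sinc
  have hm : Measurable fun x => ENNReal.ofReal (1 - Real.sinc x)⁻¹ :=
    ((measurable_const.sub hs.measurable).inv).ennreal_ofReal
  refine ⟨?_, ?_⟩
  · rw [withDensity_apply _ (measurableSet_singleton 0), Measure.restrict_restrict
      (measurableSet_singleton 0)]
    simp
  · rw [lintegral_withDensity_eq_lintegral_mul _ hm (by fun_prop)]
    refine (lintegral_mono (g := fun _ => ENNReal.ofReal 40) fun x => ?_).trans_lt ?_
    · rw [Pi.mul_apply, ← ENNReal.ofReal_mul (inv_nonneg.2 (sub_nonneg.2 (Real.sinc_le_one x)))]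
      refine ENNReal.ofReal_le_ofReal ?_
      rcases eq_or_ne x 0 with rfl | hx
      · simp
      rw [inv_mul_le_iff₀ (one_sub_sinc_pos hx), mul_comm]
      exact min_le_one_sub_sinc x
    · rw [lintegral_const]
      exact ENNReal.mul_lt_top ENNReal.ofReal_lt_top (measure_lt_top _ _)

/-- The atom at `0` contributes the Gaussian part; off `0` the density `1/(1 - sinc)` cancels the
factor that separates the two kernels. -/
theorem integral_sincKernel (G : Measure ℝ) [IsFiniteMeasure G] (u : ℝ) :
    ∫ x, sincKernel u x ∂G = -(3 * u ^ 2 : ℂ) * G.real {0} +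
      ∫ x in ({0}ᶜ : Set ℝ), levyKernel u x ∂((G.restrict {0}ᶜ).withDensity
        fun x => ENNReal.ofReal (1 - Real.sinc x)⁻¹) := by
  have hs := Real.continuous_sinc
  have hm : Measurable fun x => ENNReal.ofReal (1 - Real.sinc x)⁻¹ :=
    ((measurable_const.sub hs.measurable).inv).ennreal_ofReal
  have hi : Integrable (sincKernel u) G := by
    exact (BoundedContinuousFunction.integrable G (sincKernelBCF u))
  rw [(isLevyMeasure_withDensity_inv G).restrict_eq,
    integral_withDensity_eq_integral_toReal_smul hm (ae_of_all _ fun x => ENNReal.ofReal_lt_top),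
    ← integral_add_compl (measurableSet_singleton 0) hi]
  congr 1
  · rw [integral_singleton]
    simp [sincKernel, mul_comm]
  · refine setIntegral_congr_fun (measurableSet_singleton 0).compl fun x hx => ?_
    have hx : x ≠ 0 := hx
    rw [ENNReal.toReal_ofReal (inv_nonneg.2 (sub_nonneg.2 (Real.sinc_le_one x))),
      ← smul_sincKernel, smul_smul, inv_mul_cancel₀ (one_sub_sinc_pos hx).ne', one_smul]

/-- The measures `n (1 - sinc x) κ_{1/n}(dx)`. -/
def sincMeasure (κ : ℝ≥0 → Measure ℝ) (n : ℕ) : Measure ℝ :=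
  (κ (1 / n)).withDensity fun x => ((n * (1 - Real.sinc x)).toNNReal : ℝ≥0∞)

theorem measurable_sincDensity (n : ℕ) :
    Measurable fun x => (n * (1 - Real.sinc x)).toNNReal := by
  have := Real.continuous_sinc.measurable
  fun_prop

theorem sincMeasure_integral (κ : ℝ≥0 → Measure ℝ) (n : ℕ) (f : ℝ → ℂ) :
    ∫ x, f x ∂(sincMeasure κ n) = n * ∫ x, (1 - Real.sinc x) • f x ∂(κ (1 / n)) := by
  rw [sincMeasure, integral_withDensity_eq_integral_smul (measurable_sincDensity n),
    ← integral_const_mul]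
  congr 1 with x
  rw [NNReal.smul_def, Real.coe_toNNReal _
    (mul_nonneg n.cast_nonneg (sub_nonneg.2 (Real.sinc_le_one x)))]
  simp only [Complex.real_smul]
  push_cast
  ring

theorem isFiniteMeasure_sincMeasure {κ : ℝ≥0 → Measure ℝ} (hκ : IsLevySemigroup κ) (n : ℕ) :
    IsFiniteMeasure (sincMeasure κ n) := by
  have := hκ.prob (1 / n)
  refine isFiniteMeasure_withDensity (lt_of_le_of_lt (lintegral_mono
    (g := fun _ => ENNReal.ofReal (n * 2)) fun x => ?_) ?_).ne
  · refine ENNReal.ofReal_le_ofReal ?_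
    have := Real.neg_one_le_sinc x
    gcongr
    linarith
  · rw [lintegral_const]
    exact ENNReal.mul_lt_top ENNReal.ofReal_lt_top (measure_lt_top _ _)

/-- Combines `sincMeasure_integral` with `integral_charFun_add`. The constants `-1` cancel in the
difference, but they make each term converge as `n → ∞`. -/
theorem charFun_sincMeasure {κ : ℝ≥0 → Measure ℝ} (hκ : IsLevySemigroup κ) (n : ℕ) (u : ℝ) :
    charFun (sincMeasure κ n) u = n * (charFun (κ (1 / n)) u - 1) -
      (1 / 2) * ∫ s in (-1 : ℝ)..1, n * (charFun (κ (1 / n)) (u + s) - 1) := by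
  have := hκ.prob (1 / n)
  have hs := Real.continuous_sinc
  have hc : Continuous (charFun (κ (1 / n))) := continuous_charFun
  rw [charFun_eq_integral_exp, sincMeasure_integral, intervalIntegral.integral_const_mul,
    intervalIntegral.integral_sub ((by fun_prop : Continuous _).intervalIntegrable _ _)
      (by simp), integral_charFun_add, charFun_eq_integral_exp]
  have hi : Integrable (fun x : ℝ => Complex.exp (Complex.I * u * x) * (Real.sinc x : ℂ))
      (κ (1 / n)) := by
    refine (integrable_const (1 : ℝ)).mono' (by fun_prop) (ae_of_all _ fun x => ?_)
    have e : Complex.I * u * x = Complex.I * ((u * x : ℝ) : ℂ) := by push_cast; ring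
    rw [norm_mul, e, norm_exp_I_mul, one_mul, Complex.norm_real]
    exact Real.abs_sinc_le_one x
  have e : ∀ x : ℝ, (1 - Real.sinc x) • Complex.exp (Complex.I * u * x) =
      Complex.exp (Complex.I * u * x) - Complex.exp (Complex.I * u * x) * (Real.sinc x : ℂ) := by
    intro x; rw [Complex.real_smul]; push_cast; ring
  simp_rw [e]
  rw [integral_sub (integrable_exp_I_mul _ u) hi]
  simp
  ring

/-- The law at time one of a convolution semigroup has a Lévy–Khintchine representation. -/
theorem IsLevySemigroup.exists_hasLevyTriplet {κ : ℝ≥0 → Measure ℝ} (hκ : IsLevySemigroup κ) :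
    ∃ (a : ℝ) (σsq : ℝ≥0) (M : Measure ℝ), HasLevyTriplet (κ 1) a σsq M := by
  obtain ⟨ψ, hψ, hψn⟩ := hκ.exists_log
  have hψc := hψ.1
  let c : ℕ → ℝ → ℂ := fun n u => n * (charFun (κ (1 / n)) u - 1)
  have hcc : ∀ n, Continuous (c n) := fun n => by
    have := hκ.prob (1 / n)
    have hc : Continuous (charFun (κ (1 / n))) := continuous_charFun
    fun_prop
  have hclim : ∀ u, Tendsto (fun n => c n u) atTop (𝓝 (ψ u)) := fun u => by
    refine (tendsto_nat_mul_exp_div_sub_one (ψ u)).congr' ?_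
    filter_upwards [hψn |u|] with n hn
    simp only [c]
    rw [hn u le_rfl]
  -- Local uniform bounds, for dominated convergence of the moving average. The estimate `|e^z - 1|
  -- ≤ 2|z|` needs `|z| ≤ 1`, hence `n ≥ C`.
  have hcbd : ∀ U : ℝ, ∃ C : ℝ, ∀ᶠ n in atTop, ∀ u, |u| ≤ U → ‖c n u‖ ≤ C := fun U => by
    obtain ⟨C, hC⟩ := (isCompact_Icc (a := -U) (b := U)).exists_bound_of_continuousOn
      hψc.continuousOn
    refine ⟨2 * C, ?_⟩
    obtain ⟨N, hN⟩ := exists_nat_ge C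
    filter_upwards [hψn U, eventually_ge_atTop N, eventually_gt_atTop 0] with n hn hnN hn0 u hu
    have hu' := hC u (abs_le.1 hu)
    have hnC : C ≤ n := hN.trans (by exact_mod_cast hnN)
    have hn0' : (0 : ℝ) < n := by exact_mod_cast hn0
    have hd : ‖ψ u / n‖ = ‖ψ u‖ / n := by rw [norm_div, Complex.norm_natCast]
    have h1 := Complex.norm_exp_sub_one_le (x := ψ u / n)
      (by rw [hd, div_le_one hn0']; linarith)
    simp only [c]
    rw [hn u hu, norm_mul, Complex.norm_natCast]
    rw [hd] at h1
    calc (n : ℝ) * ‖Complex.exp (ψ u / n) - 1‖ ≤ n * (2 * (‖ψ u‖ / n)) := by gcongr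
      _ = 2 * ‖ψ u‖ := by field_simp
      _ ≤ 2 * C := by linarith
  have := isFiniteMeasure_sincMeasure hκ
  have hH : ∀ u, Tendsto (fun n => charFun (sincMeasure κ n) u) atTop
      (𝓝 (ψ u - (1 / 2) * ∫ s in (-1 : ℝ)..1, ψ (u + s))) := fun u => by
    simp_rw [charFun_sincMeasure hκ]
    refine (hclim u).sub (Tendsto.const_mul _ ?_)
    obtain ⟨C, hC⟩ := hcbd (|u| + 1)
    refine intervalIntegral.tendsto_integral_filter_of_dominated_convergence (fun _ => C)
      (.of_forall fun n => ?_) ?_ (by simp) (ae_of_all _ fun s _ => hclim (u + s))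
    · exact ((hcc n).comp (continuous_const.add continuous_id)).aestronglyMeasurable
    · filter_upwards [hC] with n hn
      refine ae_of_all _ fun s hs => hn _ ?_
      rw [uIoc_of_le (by norm_num)] at hs
      exact (abs_add_le u s).trans (by gcongr; exact abs_le.2 ⟨hs.1.le, hs.2⟩)
  have hhc : Continuous fun u => ψ u - (1 / 2) * ∫ s in (-1 : ℝ)..1, ψ (u + s) := by
    have : Continuous fun u : ℝ => ∫ s in (-1 : ℝ)..1, ψ (u + s) :=
      intervalIntegral.continuous_parametric_intervalIntegral_of_continuous'
        (f := fun u s => ψ (u + s)) (by unfold Function.uncurry; fun_prop) _ _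
    fun_prop
  obtain ⟨G, hG, hGlim⟩ := exists_tendsto_integral_of_tendsto_charFun hhc.continuousAt hH
  let b : ℕ → ℝ := fun n => n * ∫ x : ℝ, x / (1 + x ^ 2) ∂(κ (1 / n))
  -- What the weak limit does not control is a pure drift. Both terms on the left converge, so the
  -- drift does too; its limit is read off at `u = 1`.
  have hdecomp : ∀ n u, c n u - ∫ x, sincKernel u x ∂(sincMeasure κ n) = Complex.I * u * b n := by
    intro n u
    have := hκ.prob (1 / n)
    have hd := integrable_div_one_add_sq (κ (1 / n))
    have hd' : Integrable (fun x : ℝ => Complex.I * u * ((x / (1 + x ^ 2) : ℝ) : ℂ))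
        (κ (1 / n)) := hd.ofReal.const_mul _
    have e1 : charFun (κ (1 / n)) u - 1 =
        ∫ x : ℝ, (Complex.exp (Complex.I * u * x) - 1) ∂(κ (1 / n)) := by
      rw [integral_sub (integrable_exp_I_mul _ u) (integrable_const _), charFun_eq_integral_exp,
        integral_const, probReal_univ, one_smul]
    have e2 : ∫ x, levyKernel u x ∂(κ (1 / n)) =
        (∫ x : ℝ, (Complex.exp (Complex.I * u * x) - 1) ∂(κ (1 / n))) -
        ∫ x : ℝ, Complex.I * u * ((x / (1 + x ^ 2) : ℝ) : ℂ) ∂(κ (1 / n)) := by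
      rw [← integral_sub (f := fun x : ℝ => Complex.exp (Complex.I * u * x) - 1)
        ((integrable_exp_I_mul _ u).sub (integrable_const _)) hd']
      congr 1 with x
      rw [levyKernel]
      push_cast
      ring
    rw [sincMeasure_integral]
    simp_rw [smul_sincKernel]
    simp only [c, b]
    rw [e1, e2, integral_const_mul, integral_complex_ofReal]
    push_cast
    ring
  have hElim : ∀ u : ℝ, Tendsto (fun n => Complex.I * u * b n) atTop
      (𝓝 (ψ u - ∫ x, sincKernel u x ∂G)) := fun u => by
    simp_rw [← hdecomp]
    exact (hclim u).sub (hGlim (sincKernelBCF u))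
  let a : ℝ := (ψ 1 - ∫ x, sincKernel 1 x ∂G).im
  have hb : Tendsto b atTop (𝓝 a) := by
    have := (Complex.continuous_im.tendsto _).comp (hElim 1)
    simpa [Function.comp_def, a] using this
  have hψeq : ∀ u : ℝ, ψ u = Complex.I * u * a + ∫ x, sincKernel u x ∂G := fun u => by
    have h1 := tendsto_nhds_unique (hElim u)
      (((Complex.continuous_ofReal.tendsto _).comp hb).const_mul (Complex.I * u))
    rw [← h1]; ring
  -- The factor `6` matches `-3u² G{0}` with `-σ²u²/2`.
  refine ⟨a, 6 * (G {0}).toNNReal, _, isLevyMeasure_withDensity_inv G, fun u => ?_⟩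
  rw [← hψ.2.2 u, hψeq, integral_sincKernel]
  congr 1
  have : ((6 * (G {0}).toNNReal : ℝ≥0) : ℝ) = 6 * G.real {0} := by
    push_cast; rfl
  rw [this]
  simp only [levyKernel]
  push_cast
  ring


/-! ### Characteristic functions of random integrals -/

/-- Two lifts of the same map through the covering `exp`, on the connected space `ℝ`, agreeing at
`0`. -/
theorem IsLogCharFun.unique {μ : Measure ℝ} {ψ ψ' : ℝ → ℂ} (h : IsLogCharFun μ ψ)
    (h' : IsLogCharFun μ ψ') : ψ = ψ' := by
  refine Complex.isCoveringMap_exp.eq_of_comp_eq h.1 h'.1 (funext fun u => ?_) 0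
    (h.2.1.trans h'.2.1.symm)
  exact Subtype.ext ((h.2.2 u).trans (h'.2.2 u).symm)

theorem HasLevyTriplet.isLogCharFun {μ : Measure ℝ} {a : ℝ} {σsq : ℝ≥0} {M : Measure ℝ}
    (h : HasLevyTriplet μ a σsq M) : IsLogCharFun μ (levyExponent a σsq M) :=
  ⟨h.1.continuous_levyExponent a σsq, levyExponent_zero a σsq M, fun u => (h.2 u).symm⟩

/-- Write `t = ⌊tn⌋/n + s_n` with `s_n → 0`: the first part is a power of the law at time `1/n`,
where `exp(ψ/n)` is known, and the remainder disappears by continuity at time `0`. -/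
theorem IsLevySemigroup.charFun_eq_exp {κ : ℝ≥0 → Measure ℝ} (hκ : IsLevySemigroup κ) {ψ : ℝ → ℂ}
    (hψ : IsLogCharFun (κ 1) ψ) (t : ℝ≥0) (u : ℝ) :
    charFun (κ t) u = Complex.exp ((t : ℝ) * ψ u) := by
  obtain ⟨ψ', hψ', hn⟩ := hκ.exists_log
  obtain rfl := hψ.unique hψ'
  have := hκ.prob
  let m : ℕ → ℕ := fun n => ⌊(t : ℝ) * n⌋₊
  let s : ℕ → ℝ≥0 := fun n => t - m n / n
  have hle : ∀ n, (m n / n : ℝ≥0) ≤ t := fun n => by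
    refine div_le_of_le_mul₀ zero_le zero_le ?_
    rw [← NNReal.coe_le_coe]
    push_cast
    exact Nat.floor_le (by positivity)
  have hlim : Tendsto (fun n => (m n / n : ℝ≥0)) atTop (𝓝 t) := by
    have := (tendsto_nat_floor_mul_div_atTop (R := ℝ) (a := t) t.2).comp
      (tendsto_natCast_atTop_atTop (R := ℝ))
    rw [← NNReal.tendsto_coe]
    refine this.congr fun n => ?_
    simp only [Function.comp_apply, m]
    push_cast
    rfl
  have hs : Tendsto s atTop (𝓝 0) := by
    have : Tendsto s atTop (𝓝 (t - t)) := tendsto_const_nhds.sub hlim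
    simpa using this
  have h1 : Tendsto (fun n => charFun (κ (s n)) u) atTop (𝓝 1) := by
    have := tendsto_integral_charFun (μ := fun n => κ (s n)) (μ₀ := Measure.dirac 0)
      (fun f => by simpa [Function.comp_def] using (hκ.cont f).comp hs) u
    simpa [charFun_dirac] using this
  have h2 : Tendsto (fun n => Complex.exp ((m n / n : ℝ≥0) * ψ u)) atTop
      (𝓝 (Complex.exp ((t : ℝ) * ψ u))) := by
    have hc : Continuous fun x : ℝ≥0 => Complex.exp ((x : ℝ) * ψ u) := by fun_prop
    exact (hc.tendsto t).comp hlim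
  have h3 := h2.mul h1
  rw [mul_one] at h3
  refine tendsto_nhds_unique (tendsto_const_nhds.congr' ?_) h3
  filter_upwards [hn |u|, eventually_gt_atTop 0] with n hn hn0
  have e : t = m n * (1 / n) + s n := by
    rw [mul_one_div]; exact (add_tsub_cancel_of_le (hle n)).symm
  conv_lhs => rw [e]
  rw [hκ.charFun_add, hκ.charFun_nsmul, hn u le_rfl, ← Complex.exp_nat_mul]
  congr 2
  push_cast
  ring

theorem charFun_stieltjesSumLaw {κ : ℝ≥0 → Measure ℝ} (hκ : IsLevySemigroup κ) {ψ : ℝ → ℂ}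
    (hψ : IsLogCharFun (κ 1) ψ) (k : ℕ) {t : ℕ → ℝ} (ht : Monotone t) (ht0 : 0 ≤ t 0) (n : ℕ) :
    IsProbabilityMeasure (stieltjesSumLaw κ (fun t => t) (fun t => t ^ k) t n) ∧
    ∀ u, charFun (stieltjesSumLaw κ (fun t => t) (fun t => t ^ k) t n) u =
      Complex.exp (∑ j ∈ Finset.range n, ((t (j + 1) ^ k - t j ^ k : ℝ) : ℂ) * ψ (t j * u)) := by
  induction n with
  | zero => exact ⟨by rw [stieltjesSumLaw]; infer_instance, fun u => by simp [stieltjesSumLaw]⟩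
  | succ n ih =>
    have := ih.1
    have hp := hκ.prob (t (n + 1) ^ k - t n ^ k).toNNReal
    have : IsProbabilityMeasure
        ((κ (t (n + 1) ^ k - t n ^ k).toNNReal).map fun x => t n * x) :=
      Measure.isProbabilityMeasure_map (by fun_prop)
    refine ⟨by rw [stieltjesSumLaw]; infer_instance, fun u => ?_⟩
    have h0 : 0 ≤ t n := ht0.trans (ht (Nat.zero_le n))
    rw [stieltjesSumLaw, charFun_conv, ih.2, charFun_map_mul, hκ.charFun_eq_exp hψ,
      Real.coe_toNNReal _ (sub_nonneg.2 (pow_le_pow_left₀ h0 (ht (Nat.le_succ n)) k)),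
      ← Complex.exp_add, Finset.sum_range_succ]

theorem integral_natCast_mul_pow (k : ℕ) (a b : ℝ) :
    ∫ s in a..b, (k : ℝ) * s ^ (k - 1) = b ^ k - a ^ k :=
  intervalIntegral.integral_eq_sub_of_hasDerivAt (fun s _ => hasDerivAt_pow k s)
    ((by fun_prop : Continuous fun s : ℝ => (k : ℝ) * s ^ (k - 1)).intervalIntegrable _ _)

/-- Riemann–Stieltjes sums with respect to `d(s^k)` of a continuous function. -/
theorem tendsto_sum_pow_sub_mul (k : ℕ) {g : ℝ → ℂ} (hg : Continuous g) {N : ℕ → ℕ}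
    {t : ℕ → ℕ → ℝ} (ht : IsPartitionSeq 0 1 N t) :
    Tendsto (fun n => ∑ j ∈ Finset.range (N n), ((t n (j + 1) ^ k - t n j ^ k : ℝ) : ℂ) * g (t n j))
      atTop (𝓝 (∫ s in (0 : ℝ)..1, ((k * s ^ (k - 1) : ℝ) : ℂ) * g s)) := by
  have hw : Continuous fun s : ℝ => (k : ℝ) * s ^ (k - 1) := by fun_prop
  have hwg : Continuous fun s : ℝ => ((k * s ^ (k - 1) : ℝ) : ℂ) * g s := by fun_prop
  refine Metric.tendsto_nhds.2 fun ε hε => ?_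
  obtain ⟨δ, hδ, hu⟩ := Metric.uniformContinuousOn_iff.1
    (isCompact_Icc.uniformContinuousOn_of_continuous (s := Icc (0 : ℝ) 1) hg.continuousOn)
    (ε / 2) (half_pos hε)
  filter_upwards [ht.mesh δ hδ] with n hn
  have e1 : ∫ s in (0 : ℝ)..1, ((k * s ^ (k - 1) : ℝ) : ℂ) * g s =
      ∑ j ∈ Finset.range (N n), ∫ s in (t n j)..(t n (j + 1)),
        ((k * s ^ (k - 1) : ℝ) : ℂ) * g s := by
    rw [intervalIntegral.sum_integral_adjacent_intervals
      (fun _ _ => hwg.intervalIntegrable _ _), ht.left, ht.right]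
  have e2 : ∀ j, ((t n (j + 1) ^ k - t n j ^ k : ℝ) : ℂ) * g (t n j) =
      ∫ s in (t n j)..(t n (j + 1)), ((k * s ^ (k - 1) : ℝ) : ℂ) * g (t n j) := fun j => by
    rw [intervalIntegral.integral_mul_const, intervalIntegral.integral_ofReal,
      integral_natCast_mul_pow]
  have e3 : ∀ j, ((t n (j + 1) ^ k - t n j ^ k : ℝ) : ℂ) * g (t n j) -
      (∫ s in (t n j)..(t n (j + 1)), ((k * s ^ (k - 1) : ℝ) : ℂ) * g s) =
      ∫ s in (t n j)..(t n (j + 1)), ((k * s ^ (k - 1) : ℝ) : ℂ) * (g (t n j) - g s) := fun j => by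
    rw [e2, ← intervalIntegral.integral_sub
      ((by fun_prop : Continuous _).intervalIntegrable _ _) (hwg.intervalIntegrable _ _)]
    congr 1 with s
    ring
  rw [dist_eq_norm, e1, ← Finset.sum_sub_distrib]
  simp_rw [e3]
  -- Uniform continuity bounds the oscillation of `g` on each cell by `ε/2`, and the weights
  -- telescope to `1 - 0^k ≤ 1`.
  refine lt_of_le_of_lt ?_ (half_lt_self hε)
  calc ‖∑ j ∈ Finset.range (N n), ∫ s in (t n j)..(t n (j + 1)),
          ((k * s ^ (k - 1) : ℝ) : ℂ) * (g (t n j) - g s)‖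
      ≤ ∑ j ∈ Finset.range (N n), ∫ s in (t n j)..(t n (j + 1)),
          (k * s ^ (k - 1)) * (ε / 2) := by
        refine norm_sum_le_of_le _ fun j hj => ?_
        have hj' := Finset.mem_range.1 hj
        refine intervalIntegral.norm_integral_le_of_norm_le (ht.mono n (Nat.le_succ j)) ?_
          ((by fun_prop : Continuous _).intervalIntegrable _ _)
        refine ae_of_all _ fun s hs => ?_
        have h0 := ht.nonneg n j
        have h1 := ht.le_one (show j + 1 ≤ N n from hj')
        have hs0 : 0 ≤ s := h0.trans hs.1.le
        have hj1 : t n j ≤ 1 := (ht.mono n (Nat.le_succ j)).trans h1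
        have hb := hu (t n j) ⟨h0, hj1⟩ s ⟨hs0, hs.2.trans h1⟩ (by
          rw [dist_comm, Real.dist_eq, abs_of_nonneg (sub_nonneg.2 hs.1.le)]
          linarith [hn j hj', hs.2])
        rw [norm_mul, Complex.norm_real, Real.norm_of_nonneg (by positivity), ← dist_eq_norm]
        gcongr
    _ ≤ ε / 2 := by
        rw [intervalIntegral.sum_integral_adjacent_intervals
          (fun _ _ => (by fun_prop : Continuous _).intervalIntegrable _ _), ht.left, ht.right,
          intervalIntegral.integral_mul_const, integral_natCast_mul_pow, one_pow]
        nlinarith [pow_nonneg (le_refl (0 : ℝ)) k]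

/-- The logarithm of the characteristic function of `I_k(μ)` in terms of that of `μ`. -/
def powIntegralLog (k : ℕ) (ψ : ℝ → ℂ) (u : ℝ) : ℂ :=
  ∫ s in (0 : ℝ)..1, ((k * s ^ (k - 1) : ℝ) : ℂ) * ψ (s * u)

theorem continuous_powIntegralLog (k : ℕ) {ψ : ℝ → ℂ} (hψ : Continuous ψ) :
    Continuous (powIntegralLog k ψ) :=
  intervalIntegral.continuous_parametric_intervalIntegral_of_continuous'
    (f := fun u s => ((k * s ^ (k - 1) : ℝ) : ℂ) * ψ (s * u))
    (by unfold Function.uncurry; fun_prop) _ _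

theorem exists_isPartitionSeq : ∃ N t, IsPartitionSeq 0 1 N t := by
  let t : ℕ → ℕ → ℝ := fun n j => (j : ℝ) / (n + 1)
  refine ⟨fun n => n + 1, t, fun n i j hij => ?_, fun n => by simp [t], fun n => ?_,
    fun ε hε => ?_⟩
  · simp only [t]; gcongr
  · simp only [t]; push_cast; exact div_self (by positivity)
  · have := (tendsto_one_div_add_atTop_nhds_zero_nat (𝕜 := ℝ)).eventually_lt_const hε
    filter_upwards [this] with n hn j _
    simp only [t]
    have : ((j + 1 : ℕ) : ℝ) / (n + 1) - (j : ℝ) / (n + 1) = 1 / (n + 1) := by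
      push_cast; ring
    rwa [this]

theorem tendsto_charFun_stieltjesSumLaw {κ : ℝ≥0 → Measure ℝ} (hκ : IsLevySemigroup κ)
    {ψ : ℝ → ℂ} (hψ : IsLogCharFun (κ 1) ψ) (k : ℕ) {N : ℕ → ℕ} {t : ℕ → ℕ → ℝ}
    (ht : IsPartitionSeq 0 1 N t) (u : ℝ) :
    Tendsto (fun n => charFun (stieltjesSumLaw κ (fun t => t) (fun t => t ^ k) (t n) (N n)) u)
      atTop (𝓝 (Complex.exp (powIntegralLog k ψ u))) := by
  have h := fun n => (charFun_stieltjesSumLaw hκ hψ k (ht.mono n) (ht.left n).ge (N n)).2 u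
  simp_rw [h]
  have hc := hψ.1
  exact (Complex.continuous_exp.tendsto _).comp
    (tendsto_sum_pow_sub_mul k (g := fun s => ψ (s * u)) (by fun_prop) ht)

theorem IsUIntegral.isLogCharFun {k : ℕ} {μ ν : Measure ℝ} (h : IsUIntegral k μ ν) {ψ : ℝ → ℂ}
    (hψ : IsLogCharFun μ ψ) : IsLogCharFun ν (powIntegralLog k ψ) := by
  obtain ⟨hν, κ, hκ, rfl, hlim⟩ := h
  refine ⟨continuous_powIntegralLog k hψ.1, by simp [powIntegralLog, hψ.2.1], fun u => ?_⟩
  obtain ⟨N, t, ht⟩ := exists_isPartitionSeq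
  have hp := fun n => (charFun_stieltjesSumLaw hκ hψ k (ht.mono n) (ht.left n).ge (N n)).1
  exact tendsto_nhds_unique (tendsto_charFun_stieltjesSumLaw hκ hψ k ht u)
    (tendsto_integral_charFun (hlim N t ht) u)

/-- One partition sequence yields the limit law by the continuity theorem. The limiting
characteristic function is the same for all sequences, so they all converge to this law. -/
theorem IsLevySemigroup.exists_isUIntegral {κ : ℝ≥0 → Measure ℝ} (hκ : IsLevySemigroup κ)
    (k : ℕ) : ∃ ν, IsUIntegral k (κ 1) ν := by
  obtain ⟨ψ, hψ, -⟩ := hκ.exists_log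
  obtain ⟨N, t, ht⟩ := exists_isPartitionSeq
  have hp := fun {N t} (ht : IsPartitionSeq 0 1 N t) n =>
    (charFun_stieltjesSumLaw hκ hψ k (ht.mono n) (ht.left n).ge (N n)).1
  have := hp ht
  obtain ⟨ν, hν, hνc⟩ := exists_charFun_eq_of_tendsto
    (Complex.continuous_exp.comp (continuous_powIntegralLog k hψ.1)).continuousAt
    (tendsto_charFun_stieltjesSumLaw hκ hψ k ht)
  refine ⟨ν, hν, κ, hκ, rfl, fun N t ht => ?_⟩
  have := hp ht
  refine tendsto_integral_of_tendsto_charFun fun u => ?_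
  rw [hνc]
  exact tendsto_charFun_stieltjesSumLaw hκ hψ k ht u


/-! ### The Hurwitz–Lerch function as an integral -/

/-- `ℂ ∖ [1, ∞)`. -/
def slitDomain : Set ℂ := {z : ℂ | ¬ (z.im = 0 ∧ 1 ≤ z.re)}

theorem mem_slitDomain {z : ℂ} : z ∈ slitDomain ↔ ¬ (z.im = 0 ∧ 1 ≤ z.re) := Iff.rfl

theorem isOpen_slitDomain : IsOpen slitDomain := by
  have h : IsClosed {z : ℂ | z.im = 0 ∧ 1 ≤ z.re} :=
    (isClosed_eq Complex.continuous_im continuous_const).inter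
      (isClosed_le continuous_const Complex.continuous_re)
  exact h.isOpen_compl

/-- Supplies the connectedness needed for the identity theorem. -/
theorem starConvex_slitDomain : StarConvex ℝ 0 slitDomain := by
  intro z hz a b ha hb hab
  rw [mem_slitDomain] at hz ⊢
  simp only [smul_zero, zero_add, Complex.real_smul, Complex.mul_im, Complex.ofReal_re,
    Complex.ofReal_im, zero_mul, add_zero, Complex.mul_re, sub_zero]
  rintro ⟨h1, h2⟩
  rcases mul_eq_zero.1 h1 with h | h
  · rw [h] at h2; simp at h2; linarith
  · refine hz ⟨h, ?_⟩
    by_contra! hlt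
    rcases hb.eq_or_lt with rfl | hb0
    · linarith
    · nlinarith

theorem one_sub_mul_ne_zero {z : ℂ} (hz : z ∈ slitDomain) {s : ℝ} (hs : s ∈ Icc (0 : ℝ) 1) :
    1 - s * z ≠ 0 := by
  intro h
  have hre := congrArg Complex.re h
  have him := congrArg Complex.im h
  simp at hre him
  rcases him with h0 | h0
  · rw [h0] at hre; simp at hre
  · refine hz ⟨h0, ?_⟩
    have h2 := hs.2
    have h1 := hs.1
    by_contra! hlt
    rcases h1.eq_or_lt with rfl | hs0
    · linarith
    · nlinarith

/-- The integral representation `∫_0^1 s^{k-1} / (1 - sz) ds` of `Φ(z, 1, k)`. -/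
def lerchIntegral (k : ℕ) (z : ℂ) : ℂ := ∫ s in (0 : ℝ)..1, ((s ^ (k - 1) : ℝ) : ℂ) / (1 - s * z)

theorem continuousOn_lerchIntegrand (k : ℕ) :
    ContinuousOn (fun p : ℂ × ℝ => ((p.2 ^ (k - 1) : ℝ) : ℂ) / (1 - p.2 * p.1))
      (slitDomain ×ˢ Icc (0 : ℝ) 1) :=
  ContinuousOn.div (by fun_prop) (by fun_prop) fun p hp => one_sub_mul_ne_zero hp.1 hp.2

theorem continuousOn_lerchIntegrand_deriv (k : ℕ) :
    ContinuousOn (fun p : ℂ × ℝ => ((p.2 ^ (k - 1) : ℝ) : ℂ) * p.2 / (1 - p.2 * p.1) ^ 2)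
      (slitDomain ×ˢ Icc (0 : ℝ) 1) :=
  ContinuousOn.div (by fun_prop) (by fun_prop) fun p hp =>
    pow_ne_zero 2 (one_sub_mul_ne_zero hp.1 hp.2)

theorem intervalIntegrable_lerchIntegrand (k : ℕ) {z : ℂ} (hz : z ∈ slitDomain) :
    IntervalIntegrable (fun s : ℝ => ((s ^ (k - 1) : ℝ) : ℂ) / (1 - s * z)) volume 0 1 := by
  refine ContinuousOn.intervalIntegrable ?_
  rw [uIcc_of_le zero_le_one]
  exact (continuousOn_lerchIntegrand k).comp (f := fun s : ℝ => (z, s)) (by fun_prop)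
    fun s hs => ⟨hz, hs⟩

/-- Differentiation under the integral sign; the derivative of the integrand is bounded on the
compact product of a small closed ball and `[0,1]`. -/
theorem differentiableOn_lerchIntegral (k : ℕ) :
    DifferentiableOn ℂ (lerchIntegral k) slitDomain := by
  intro z hz
  obtain ⟨r, hr, hball⟩ := Metric.nhds_basis_closedBall.mem_iff.1 (isOpen_slitDomain.mem_nhds hz)
  obtain ⟨C, hC⟩ := ((isCompact_closedBall z r).prod (isCompact_Icc (a := (0 : ℝ)) (b := 1))
    ).exists_bound_of_continuousOn ((continuousOn_lerchIntegrand_deriv k).mono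
      (prod_mono_left hball))
  have hI : ∀ s ∈ uIoc (0 : ℝ) 1, s ∈ Icc (0 : ℝ) 1 := fun s hs => by
    rw [uIoc_of_le zero_le_one] at hs; exact Ioc_subset_Icc_self hs
  have hderiv : IntervalIntegrable
      (fun s : ℝ => ((s ^ (k - 1) : ℝ) : ℂ) * s / (1 - s * z) ^ 2) volume 0 1 := by
    refine ContinuousOn.intervalIntegrable ?_
    rw [uIcc_of_le zero_le_one]
    exact (continuousOn_lerchIntegrand_deriv k).comp (f := fun s : ℝ => (z, s)) (by fun_prop)
      fun s hs => ⟨hz, hs⟩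
  have := (intervalIntegral.hasDerivAt_integral_of_dominated_loc_of_deriv_le
    (F := fun z (s : ℝ) => ((s ^ (k - 1) : ℝ) : ℂ) / (1 - s * z))
    (F' := fun z (s : ℝ) => ((s ^ (k - 1) : ℝ) : ℂ) * s / (1 - s * z) ^ 2)
    (bound := fun _ => C) (μ := volume) (a := 0) (b := 1)
    (Metric.closedBall_mem_nhds z hr) ?_ (intervalIntegrable_lerchIntegrand k hz)
    hderiv.def'.aestronglyMeasurable
    (ae_of_all _ fun s hs w hw => hC (w, s) ⟨hw, hI s hs⟩) (by simp)
    (ae_of_all _ fun s hs w hw => ?_)).2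
  · exact this.differentiableAt.differentiableWithinAt
  · filter_upwards [isOpen_slitDomain.mem_nhds hz] with w hw
    exact (intervalIntegrable_lerchIntegrand k hw).def'.aestronglyMeasurable
  · have hne := one_sub_mul_ne_zero (hball hw) (hI s hs)
    have h1 : HasDerivAt (fun w : ℂ => 1 - s * w) (-s) w := by
      simpa using ((hasDerivAt_id w).const_mul (s : ℂ)).const_sub 1
    have := (hasDerivAt_const w ((s ^ (k - 1) : ℝ) : ℂ)).div h1 hne
    convert! this using 1
    simp

/-- Expand `1/(1 - sz)` geometrically and integrate termwise, dominated by `‖z‖^n`. The condition `1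
≤ k` makes the truncated exponent `k - 1 + n` integrate to `1/(k + n)`. -/
theorem hasSum_lerchIntegral {k : ℕ} (hk : 1 ≤ k) {z : ℂ} (hz : ‖z‖ < 1) :
    HasSum (fun n : ℕ => z ^ n / ((k : ℂ) + n) ^ (1 : ℂ)) (lerchIntegral k z) := by
  have hterm : ∀ n : ℕ, ∫ s in (0 : ℝ)..1, ((s ^ (k - 1) : ℝ) : ℂ) * (s * z) ^ n =
      z ^ n / ((k : ℂ) + n) ^ (1 : ℂ) := by
    intro n
    have e : ∀ s : ℝ, ((s ^ (k - 1) : ℝ) : ℂ) * (s * z) ^ n =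
        ((s ^ (k - 1 + n) : ℝ) : ℂ) * z ^ n := fun s => by push_cast; ring
    simp_rw [e]
    rw [intervalIntegral.integral_mul_const, intervalIntegral.integral_ofReal, integral_pow,
      Complex.cpow_one]
    have : ((k - 1 + n : ℕ) : ℝ) + 1 = k + n := by
      rw [← Nat.cast_add_one, ← Nat.cast_add]; congr 1; omega
    rw [this]
    simp
    ring
  simp_rw [← hterm]
  have hI : ∀ s ∈ uIoc (0 : ℝ) 1, s ∈ Icc (0 : ℝ) 1 := fun s hs => by
    rw [uIoc_of_le zero_le_one] at hs; exact Ioc_subset_Icc_self hs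
  have hle : ∀ s ∈ Icc (0 : ℝ) 1, ‖(s : ℂ) * z‖ ≤ ‖z‖ := fun s hs => by
    rw [norm_mul, Complex.norm_real, Real.norm_of_nonneg hs.1]
    exact mul_le_of_le_one_left (norm_nonneg z) hs.2
  refine intervalIntegral.hasSum_integral_of_dominated_convergence (fun n _ => ‖z‖ ^ n)
    (fun n => Continuous.aestronglyMeasurable (by fun_prop))
    (fun n => ae_of_all _ fun s hs => ?_)
    (ae_of_all _ fun s _ => summable_geometric_of_lt_one (norm_nonneg z) hz) (by simp)
    (ae_of_all _ fun s hs => ?_)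
  · rw [norm_mul, norm_pow, Complex.norm_real, Real.norm_of_nonneg (pow_nonneg (hI s hs).1 _)]
    have := pow_le_one₀ (n := k - 1) (hI s hs).1 (hI s hs).2
    calc s ^ (k - 1) * ‖(s : ℂ) * z‖ ^ n ≤ 1 * ‖z‖ ^ n := by
          gcongr; exact hle s (hI s hs)
      _ = ‖z‖ ^ n := one_mul _
  · rw [div_eq_mul_inv]
    exact (hasSum_geometric_of_norm_lt_one ((hle s (hI s hs)).trans_lt hz)).mul_left _

theorem IsHurwitzLerch.eqOn {s v : ℂ} {f g : ℂ → ℂ} (hf : IsHurwitzLerch s v f)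
    (hg : IsHurwitzLerch s v g) : EqOn f g slitDomain := by
  have hfa : AnalyticOnNhd ℂ f slitDomain := hf.1.analyticOnNhd isOpen_slitDomain
  have hga : AnalyticOnNhd ℂ g slitDomain := hg.1.analyticOnNhd isOpen_slitDomain
  have h0 : (0 : ℂ) ∈ slitDomain := by rw [mem_slitDomain]; simp
  refine hfa.eqOn_of_preconnected_of_eventuallyEq hga
    (starConvex_slitDomain.isPathConnected h0).isConnected.isPreconnected h0 ?_
  filter_upwards [Metric.ball_mem_nhds (0 : ℂ) one_pos] with z hz
  rw [mem_ball_zero_iff] at hz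
  exact (hf.2 z hz).unique (hg.2 z hz)

theorem isHurwitzLerch_lerchIntegral {k : ℕ} (hk : 1 ≤ k) :
    IsHurwitzLerch 1 k (lerchIntegral k) :=
  ⟨differentiableOn_lerchIntegral k, fun _ hz => hasSum_lerchIntegral hk hz⟩

/-- The integral shows that a continuation exists, so the chosen one is genuine; by the identity
theorem the choice does not matter on the slit domain. -/
theorem hurwitzLerch_eq {k : ℕ} (hk : 1 ≤ k) {z : ℂ} (hz : z ∈ slitDomain) :
    hurwitzLerch z 1 k = lerchIntegral k z :=
  (Classical.epsilon_spec (p := IsHurwitzLerch 1 k)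
    ⟨_, isHurwitzLerch_lerchIntegral hk⟩).eqOn (isHurwitzLerch_lerchIntegral hk) hz


/-! ### Laplace transforms -/

theorem integral_pow_mul_exp_neg (n : ℕ) {t : ℝ} (ht : 0 < t) :
    ∫ u in Ioi (0 : ℝ), u ^ n * Real.exp (-(t * u)) = n.factorial / t ^ (n + 1) := by
  have h := Real.integral_rpow_mul_exp_neg_mul_Ioi (a := n + 1) (by positivity) ht
  rw [Real.Gamma_nat_eq_factorial] at h
  simp only [add_sub_cancel_right, Real.rpow_natCast] at h
  rw [h, ← Nat.cast_add_one, Real.rpow_natCast, one_div, inv_pow, div_eq_inv_mul]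

theorem integrableOn_pow_mul_exp_neg (n : ℕ) {t : ℝ} (ht : 0 < t) :
    IntegrableOn (fun u : ℝ => u ^ n * Real.exp (-(t * u))) (Ioi 0) := by
  -- A non-integrable function has integral `0` by convention, whereas this one has a positive
  -- value.
  by_contra h
  have h1 := integral_undef h
  rw [integral_pow_mul_exp_neg n ht] at h1
  have : 0 < (n.factorial : ℝ) / t ^ (n + 1) := by positivity
  exact this.ne' h1

theorem pow_mul_cexp_neg_eq (n : ℕ) (t u : ℝ) : (u : ℂ) ^ n * Complex.exp (-((t : ℂ) * u)) =
    ((u ^ n * Real.exp (-(t * u)) : ℝ) : ℂ) := by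
  push_cast; rfl

theorem integral_pow_mul_cexp_neg (n : ℕ) {t : ℝ} (ht : 0 < t) :
    ∫ u in Ioi (0 : ℝ), (u : ℂ) ^ n * Complex.exp (-((t : ℂ) * u)) =
      n.factorial / (t : ℂ) ^ (n + 1) := by
  simp_rw [pow_mul_cexp_neg_eq]
  rw [integral_complex_ofReal, integral_pow_mul_exp_neg n ht]
  push_cast
  rfl

theorem integrableOn_pow_mul_cexp_neg (n : ℕ) {t : ℝ} (ht : 0 < t) :
    IntegrableOn (fun u : ℝ => (u : ℂ) ^ n * Complex.exp (-((t : ℂ) * u))) (Ioi 0) := by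
  simp_rw [pow_mul_cexp_neg_eq]
  exact (integrableOn_pow_mul_exp_neg n ht).ofReal

theorem integral_levyKernel_mul_exp {t : ℝ} (ht : 0 < t) (s x : ℝ) :
    ∫ u in Ioi (0 : ℝ), levyKernel (s * -u) x * Complex.exp (-((t : ℂ) * u)) =
      1 / (t + Complex.I * s * x) - 1 / t + Complex.I * s * x / ((1 + (x : ℂ) ^ 2) * t ^ 2) := by
  have hre : (-(t + Complex.I * s * x) : ℂ).re < 0 := by simp [ht]
  have hne : (t + Complex.I * s * x : ℂ) ≠ 0 := by
    intro h; rw [h] at hre; simp at hre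
  have htc : (t : ℂ) ≠ 0 := by exact_mod_cast ht.ne'
  have hx := one_add_ofReal_sq_ne_zero x
  have e : ∀ u : ℝ, levyKernel (s * -u) x * Complex.exp (-((t : ℂ) * u)) =
      Complex.exp (-(t + Complex.I * s * x) * u) - (u : ℂ) ^ 0 * Complex.exp (-((t : ℂ) * u)) +
        Complex.I * s * x / (1 + (x : ℂ) ^ 2) * ((u : ℂ) ^ 1 * Complex.exp (-((t : ℂ) * u))) := by
    intro u
    have : Complex.exp (-(t + Complex.I * s * x) * u) =
        Complex.exp (Complex.I * (s * -u : ℝ) * x) * Complex.exp (-((t : ℂ) * u)) := by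
      rw [← Complex.exp_add]; congr 1; push_cast; ring
    rw [this, levyKernel]
    push_cast
    ring
  simp_rw [e]
  have h0 := integrableOn_exp_mul_complex_Ioi hre 0
  have h01 : IntegrableOn (fun u : ℝ => Complex.exp (-(t + Complex.I * s * x) * u) -
      (u : ℂ) ^ 0 * Complex.exp (-((t : ℂ) * u))) (Ioi 0) :=
    h0.sub (integrableOn_pow_mul_cexp_neg 0 ht)
  rw [integral_add h01
      ((integrableOn_pow_mul_cexp_neg 1 ht).const_mul _),
    integral_sub h0 (integrableOn_pow_mul_cexp_neg 0 ht), integral_const_mul,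
    integral_pow_mul_cexp_neg 0 ht, integral_pow_mul_cexp_neg 1 ht,
    integral_exp_mul_complex_Ioi hre, neg_div_neg_eq]
  simp only [Complex.ofReal_zero, mul_zero, Complex.exp_zero, Nat.factorial, Nat.cast_one]
  field_simp
  ring

/-! ### The free transform of `I_k(μ)` -/

theorem integral_mul_pow_mul_pow {k : ℕ} (hk : 1 ≤ k) (j : ℕ) :
    ∫ s in (0 : ℝ)..1, ((k * s ^ (k - 1) : ℝ) : ℂ) * (s : ℂ) ^ j = k / (k + j) := by
  have e : ∀ s : ℝ, ((k * s ^ (k - 1) : ℝ) : ℂ) * (s : ℂ) ^ j = ((k * s ^ (k - 1 + j) : ℝ) : ℂ) :=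
    fun s => by push_cast; ring
  simp_rw [e]
  rw [intervalIntegral.integral_ofReal, intervalIntegral.integral_const_mul, integral_pow]
  have : ((k - 1 + j : ℕ) : ℝ) + 1 = k + j := by
    rw [← Nat.cast_add_one, ← Nat.cast_add]; congr 1; omega
  rw [this]
  simp
  ring

/-- The integrand of the triple integral whose iterated integrals are `kernelM` and the Laplace
transform of `powIntegralLog`. -/
def laplaceIntegrand (k : ℕ) (t : ℝ) (p : ℝ × ℝ) (x : ℝ) : ℂ :=
  ((k * p.2 ^ (k - 1) : ℝ) : ℂ) * levyKernel (p.2 * -p.1) x * Complex.exp (-((t : ℂ) * p.1))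

theorem continuous_laplaceIntegrand (k : ℕ) (t : ℝ) :
    Continuous (Function.uncurry (laplaceIntegrand k t)) := by
  have := continuous_levyKernel.comp
    (by fun_prop : Continuous fun q : (ℝ × ℝ) × ℝ => (q.1.2 * -q.1.1, q.2))
  unfold Function.uncurry laplaceIntegrand
  simp only [Function.comp_def] at this
  fun_prop

/-- Lebesgue measure on `(0, ∞) × (0, 1]`. -/
def stripMeasure : Measure (ℝ × ℝ) :=
  (volume.restrict (Ioi (0 : ℝ))).prod (volume.restrict (Ioc (0 : ℝ) 1))

instance : SFinite stripMeasure := by unfold stripMeasure; infer_instance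

/-- The dominating function for `laplaceIntegrand`. -/
def laplaceBound (k : ℕ) (t : ℝ) (p : ℝ × ℝ) : ℝ :=
  ((2 + p.1 + 2 * p.1 ^ 2) * Real.exp (-(t * p.1))) * k

theorem integrable_laplaceBound (k : ℕ) {t : ℝ} (ht : 0 < t) :
    Integrable (laplaceBound k t) stripMeasure := by
  have h : IntegrableOn (fun u : ℝ => (2 + u + 2 * u ^ 2) * Real.exp (-(t * u))) (Ioi 0) := by
    have := (((integrableOn_pow_mul_exp_neg 0 ht).const_mul 2).add
      (integrableOn_pow_mul_exp_neg 1 ht)).add ((integrableOn_pow_mul_exp_neg 2 ht).const_mul 2)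
    refine this.congr (ae_of_all _ fun u => ?_)
    simp only [Pi.add_apply]
    ring
  exact Integrable.mul_prod h (integrable_const (k : ℝ))

theorem ae_stripMeasure : ∀ᵐ p ∂stripMeasure, 0 < p.1 ∧ p.2 ∈ Ioc (0 : ℝ) 1 := by
  rw [stripMeasure, Measure.prod_restrict]
  filter_upwards [ae_restrict_mem (measurableSet_Ioi.prod measurableSet_Ioc)] with p hp
  exact hp

theorem norm_laplaceIntegrand_le (k : ℕ) (t : ℝ) {p : ℝ × ℝ} (h1 : 0 < p.1)
    (h2 : p.2 ∈ Ioc (0 : ℝ) 1) (x : ℝ) :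
    ‖laplaceIntegrand k t p x‖ ≤ laplaceBound k t p * min 1 (x ^ 2) := by
  have hs0 := h2.1.le
  have hv : |p.2 * -p.1| ≤ p.1 := by
    rw [abs_mul, abs_neg, abs_of_nonneg hs0, abs_of_pos h1]
    exact mul_le_of_le_one_left h1.le h2.2
  have hv2 : (p.2 * -p.1) ^ 2 ≤ p.1 ^ 2 := by rw [← sq_abs]; gcongr
  have hker : ‖levyKernel (p.2 * -p.1) x‖ ≤ (2 + p.1 + 2 * p.1 ^ 2) * min 1 (x ^ 2) :=
    (norm_levyKernel_le _ x).trans (by gcongr)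
  have hw : ‖((k * p.2 ^ (k - 1) : ℝ) : ℂ)‖ ≤ k := by
    rw [Complex.norm_real, Real.norm_of_nonneg (by positivity)]
    exact mul_le_of_le_one_right k.cast_nonneg (pow_le_one₀ hs0 h2.2)
  have he : ‖Complex.exp (-((t : ℂ) * p.1))‖ = Real.exp (-(t * p.1)) := by
    rw [Complex.norm_exp]; simp
  rw [laplaceIntegrand, norm_mul, norm_mul, he, laplaceBound]
  calc _ ≤ (k : ℝ) * ((2 + p.1 + 2 * p.1 ^ 2) * min 1 (x ^ 2)) * Real.exp (-(t * p.1)) := by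
        gcongr
    _ = _ := by ring

theorem IsLevyMeasure.integrable_laplaceIntegrand {M : Measure ℝ} (hM : IsLevyMeasure M) (k : ℕ)
    {t : ℝ} (ht : 0 < t) :
    Integrable (Function.uncurry (laplaceIntegrand k t)) (stripMeasure.prod M) := by
  have := hM.sFinite
  refine ((integrable_laplaceBound k ht).mul_prod hM.integrable_min).mono'
    (continuous_laplaceIntegrand k t).aestronglyMeasurable ?_
  have h : ∀ᵐ q ∂(stripMeasure.prod M), 0 < q.1.1 ∧ q.1.2 ∈ Ioc (0 : ℝ) 1 :=
    Measure.quasiMeasurePreserving_fst.ae ae_stripMeasure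
  filter_upwards [h] with q hq
  exact norm_laplaceIntegrand_le k t hq.1 hq.2 q.2

theorem integrable_laplaceIntegrand_right (k : ℕ) {t : ℝ} (ht : 0 < t) (x : ℝ) :
    Integrable (fun p => laplaceIntegrand k t p x) stripMeasure := by
  refine ((integrable_laplaceBound k ht).mul_const (min 1 (x ^ 2))).mono'
    ((continuous_laplaceIntegrand k t).comp
      (Continuous.prodMk_left x)).aestronglyMeasurable ?_
  filter_upwards [ae_stripMeasure] with p hp
  exact norm_laplaceIntegrand_le k t hp.1 hp.2 x

/-- The point is `-i x/t`, on the imaginary axis, which misses `[1, ∞)`. -/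
theorem div_I_mul_mem_slitDomain (t x : ℝ) : (x / (Complex.I * t) : ℂ) ∈ slitDomain := by
  have : (x / (Complex.I * t) : ℂ) = -Complex.I * ((x / t : ℝ) : ℂ) := by
    rw [← div_div, div_eq_mul_inv (x : ℂ), Complex.inv_I]; push_cast; ring
  rw [this, mem_slitDomain]
  rintro ⟨-, h⟩
  simp at h
  norm_num at h

/-- Integrate first in `u`, then in `s`. Since `t + isx = t(1 - s x/(it))`, the resolvent term
becomes the integrand of `lerchIntegral`, and the other two terms are moments of `k s^(k-1) ds`. -/
theorem kernelM_eq_integral {k : ℕ} (hk : 1 ≤ k) {t : ℝ} (ht : 0 < t) (x : ℝ) :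
    kernelM k t x = Complex.I * (t : ℂ) ^ 2 * ∫ p, laplaceIntegrand k t p x ∂stripMeasure := by
  have hz := div_I_mul_mem_slitDomain t x
  have htc : (t : ℂ) ≠ 0 := by exact_mod_cast ht.ne'
  have hx := one_add_ofReal_sq_ne_zero x
  have e1 : ∫ p, laplaceIntegrand k t p x ∂stripMeasure = ∫ s in (0 : ℝ)..1,
      ((k * s ^ (k - 1) : ℝ) : ℂ) * (1 / (t + Complex.I * s * x) - 1 / t +
        Complex.I * s * x / ((1 + (x : ℂ) ^ 2) * t ^ 2)) := by
    have h := integrable_laplaceIntegrand_right k ht x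
    rw [stripMeasure] at h ⊢
    rw [integral_prod_symm _ h, intervalIntegral.integral_of_le zero_le_one]
    congr 1 with s
    rw [← integral_levyKernel_mul_exp ht, ← integral_const_mul]
    congr 1 with u
    rw [laplaceIntegrand]
    ring
  have e2 : ∀ s ∈ uIcc (0 : ℝ) 1, Complex.I * (t : ℂ) ^ 2 * (((k * s ^ (k - 1) : ℝ) : ℂ) *
      (1 / (t + Complex.I * s * x) - 1 / t + Complex.I * s * x / ((1 + (x : ℂ) ^ 2) * t ^ 2))) =
      k * (Complex.I * t) * (((s ^ (k - 1) : ℝ) : ℂ) / (1 - s * (x / (Complex.I * t)))) -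
      Complex.I * t * (((k * s ^ (k - 1) : ℝ) : ℂ) * (s : ℂ) ^ 0) -
      (x / (1 + (x : ℂ) ^ 2)) * (((k * s ^ (k - 1) : ℝ) : ℂ) * (s : ℂ) ^ 1) := by
    intro s hs
    rw [uIcc_of_le zero_le_one] at hs
    have hne := one_sub_mul_ne_zero hz hs
    have e : (t + Complex.I * s * x : ℂ) = t * (1 - s * (x / (Complex.I * t))) := by
      field_simp
      linear_combination (s * x : ℂ) * Complex.I_sq
    rw [e]
    set d : ℂ := 1 - s * (x / (Complex.I * t)) with hd
    push_cast
    field_simp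
    linear_combination (k * s ^ (k - 1) * d * s * x : ℂ) * Complex.I_sq
  rw [kernelM, hurwitzLerch_eq hk hz, e1, ← intervalIntegral.integral_const_mul,
    intervalIntegral.integral_congr e2]
  rw [intervalIntegral.integral_sub, intervalIntegral.integral_sub,
    intervalIntegral.integral_const_mul, intervalIntegral.integral_const_mul,
    intervalIntegral.integral_const_mul, integral_mul_pow_mul_pow hk, integral_mul_pow_mul_pow hk]
  · have : (k : ℂ) ≠ 0 := by exact_mod_cast (by omega : k ≠ 0)
    rw [lerchIntegral]
    push_cast
    rw [add_zero, div_self this]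
    ring
  · exact (intervalIntegrable_lerchIntegrand k hz).const_mul _
  · exact (by fun_prop : Continuous _).intervalIntegrable _ _
  · exact ((intervalIntegrable_lerchIntegrand k hz).const_mul _).sub
      ((by fun_prop : Continuous _).intervalIntegrable _ _)
  · exact (by fun_prop : Continuous _).intervalIntegrable _ _

/-- As a partial integral of an integrable function of `(u, s, x)`, the kernel is integrable without
any estimate on the Hurwitz–Lerch function. -/
theorem IsLevyMeasure.integrable_kernelM {M : Measure ℝ} (hM : IsLevyMeasure M) {k : ℕ}
    (hk : 1 ≤ k) {t : ℝ} (ht : 0 < t) : Integrable (kernelM k t) M := by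
  have := hM.sFinite
  rw [funext (kernelM_eq_integral hk ht)]
  exact (hM.integrable_laplaceIntegrand k ht).integral_prod_right.const_mul _

theorem powIntegralLog_levyExponent {k : ℕ} (hk : 1 ≤ k) {M : Measure ℝ} (hM : IsLevyMeasure M)
    (a : ℝ) (σsq : ℝ≥0) (u : ℝ) :
    powIntegralLog k (levyExponent a σsq M) u =
      Complex.I * a * (k / (k + 1)) * u - (1 / 2) * ((σsq : ℝ) : ℂ) * (k / (k + 2)) * u ^ 2 +
      ∫ s in (0 : ℝ)..1, ((k * s ^ (k - 1) : ℝ) : ℂ) * ∫ x, levyKernel (s * u) x ∂M := by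
  have hc := hM.continuous_integral_levyKernel.comp (by fun_prop : Continuous fun s : ℝ => s * u)
  simp only [Function.comp_def] at hc
  have e : ∀ s : ℝ, ((k * s ^ (k - 1) : ℝ) : ℂ) * levyExponent a σsq M (s * u) =
      Complex.I * a * u * (((k * s ^ (k - 1) : ℝ) : ℂ) * (s : ℂ) ^ 1) -
      (1 / 2) * ((σsq : ℝ) : ℂ) * u ^ 2 * (((k * s ^ (k - 1) : ℝ) : ℂ) * (s : ℂ) ^ 2) +
      ((k * s ^ (k - 1) : ℝ) : ℂ) * ∫ x, levyKernel (s * u) x ∂M := by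
    intro s
    rw [levyExponent_eq hM]
    push_cast
    ring
  rw [powIntegralLog]
  simp_rw [e]
  rw [intervalIntegral.integral_add, intervalIntegral.integral_sub,
    intervalIntegral.integral_const_mul, intervalIntegral.integral_const_mul,
    integral_mul_pow_mul_pow hk, integral_mul_pow_mul_pow hk]
  · push_cast
    ring
  all_goals exact (by fun_prop : Continuous _).intervalIntegrable _ _

/-- The transform defining the free counterpart of `I_k(μ)`, for `μ = [a, σ², M]`. -/
theorem laplace_powIntegralLog_eq_transformM {k : ℕ} (hk : 1 ≤ k) {M : Measure ℝ}
    (hM : IsLevyMeasure M) (a : ℝ) (σsq : ℝ≥0) {t : ℝ} (ht : 0 < t) :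
    Complex.I * (t : ℂ) ^ 2 * ∫ u in Ioi (0 : ℝ),
      powIntegralLog k (levyExponent a σsq M) (-u) * Complex.exp (-((t : ℂ) * u)) =
      transformM k a σsq M t := by
  have := hM.sFinite
  have htc : (t : ℂ) ≠ 0 := by exact_mod_cast ht.ne'
  have hint := hM.integrable_laplaceIntegrand k ht
  have hp : Integrable (fun p => ∫ x, laplaceIntegrand k t p x ∂M) stripMeasure :=
    hint.integral_prod_left
  have hR : ∀ u : ℝ, (∫ s in Ioc (0 : ℝ) 1, ∫ x, laplaceIntegrand k t (u, s) x ∂M) =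
      (∫ s in (0 : ℝ)..1, ((k * s ^ (k - 1) : ℝ) : ℂ) * ∫ x, levyKernel (s * -u) x ∂M) *
        Complex.exp (-((t : ℂ) * u)) := by
    intro u
    rw [intervalIntegral.integral_of_le zero_le_one, ← integral_mul_const]
    congr 1 with s
    rw [← integral_const_mul, ← integral_mul_const]
    rfl
  have hRi : IntegrableOn (fun u : ℝ => ∫ s in Ioc (0 : ℝ) 1,
      ∫ x, laplaceIntegrand k t (u, s) x ∂M) (Ioi 0) := hp.integral_prod_left
  -- Fubini moves the integral against `M` outermost, leaving for each `x` the strip integral that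
  -- computes the kernel.
  have hF : ∫ u in Ioi (0 : ℝ), ∫ s in Ioc (0 : ℝ) 1, ∫ x, laplaceIntegrand k t (u, s) x ∂M =
      ∫ x, ∫ p, laplaceIntegrand k t p x ∂stripMeasure ∂M := by
    rw [← integral_integral_swap hint]
    exact (integral_prod _ hp).symm
  have e : ∀ u : ℝ, powIntegralLog k (levyExponent a σsq M) (-u) *
      Complex.exp (-((t : ℂ) * u)) =
      -(Complex.I * a * (k / (k + 1))) * ((u : ℂ) ^ 1 * Complex.exp (-((t : ℂ) * u))) +
      -((1 / 2) * ((σsq : ℝ) : ℂ) * (k / (k + 2))) * ((u : ℂ) ^ 2 * Complex.exp (-((t : ℂ) * u))) +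
      ∫ s in Ioc (0 : ℝ) 1, ∫ x, laplaceIntegrand k t (u, s) x ∂M := by
    intro u
    rw [powIntegralLog_levyExponent hk hM, hR]
    push_cast
    ring
  simp_rw [e]
  have h1 := (integrableOn_pow_mul_cexp_neg 1 ht).const_mul (-(Complex.I * a * (k / (k + 1))))
  have h2 := (integrableOn_pow_mul_cexp_neg 2 ht).const_mul
    (-((1 / 2) * ((σsq : ℝ) : ℂ) * (k / (k + 2))))
  have h12 : IntegrableOn (fun u : ℝ =>
      -(Complex.I * a * (k / (k + 1))) * ((u : ℂ) ^ 1 * Complex.exp (-((t : ℂ) * u))) +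
      -((1 / 2) * ((σsq : ℝ) : ℂ) * (k / (k + 2))) *
        ((u : ℂ) ^ 2 * Complex.exp (-((t : ℂ) * u)))) (Ioi 0) := h1.add h2
  rw [integral_add h12 hRi, integral_add h1 h2, integral_const_mul, integral_const_mul,
    integral_pow_mul_cexp_neg 1 ht, integral_pow_mul_cexp_neg 2 ht, hF, transformM,
    hM.restrict_eq, mul_add, ← integral_const_mul]
  simp_rw [kernelM_eq_integral hk ht]
  congr 1
  have h3 : (k : ℂ) + 1 ≠ 0 := by exact_mod_cast (by omega : k + 1 ≠ 0)
  have h4 : (k : ℂ) + 2 ≠ 0 := by exact_mod_cast (by omega : k + 2 ≠ 0)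
  push_cast [Nat.factorial]
  field_simp
  rw [Complex.I_sq]
  ring


/-! ### The class of free counterparts -/

theorem VoiculescuOnAxis.congr {ν : Measure ℝ} {W W' : ℝ → ℂ} (h : ∀ t, 0 < t → W t = W' t) :
    VoiculescuOnAxis ν W ↔ VoiculescuOnAxis ν W' :=
  exists_congr fun _ => and_congr_right fun _ => forall₂_congr fun t ht => by rw [h t ht]

theorem isFreeCounterpart_iff_transformM {k : ℕ} (hk : 1 ≤ k) {a : ℝ} {σsq : ℝ≥0}
    {M μ ν ν' : Measure ℝ} (hμ : HasLevyTriplet μ a σsq M) (hν : IsUIntegral k μ ν) :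
    IsFreeCounterpart ν ν' ↔ VoiculescuOnAxis ν' (transformM k a σsq M) := by
  have hlog := hν.isLogCharFun hμ.isLogCharFun
  rw [← VoiculescuOnAxis.congr fun t ht => laplace_powIntegralLog_eq_transformM hk hμ.1 a σsq ht]
  refine ⟨?_, fun h => ⟨_, hlog, h⟩⟩
  rintro ⟨ψ, hψ, h⟩
  rwa [hψ.unique hlog] at h

/-- Forwards, the semigroup contained in the random integral has a Lévy–Khintchine triplet.
Backwards, the triplet generates a semigroup, whose law at time one is infinitely divisible and
whose random integral exists. -/
theorem freeClassU_iff {k : ℕ} (hk : 1 ≤ k) {ν' : Measure ℝ} (hν' : IsProbabilityMeasure ν') :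
    FreeClassU k ν' ↔ ∃ (a : ℝ) (σsq : ℝ≥0) (M : Measure ℝ), IsLevyMeasure M ∧
      VoiculescuOnAxis ν' (transformM k a σsq M) := by
  constructor
  · rintro ⟨-, ν, ⟨μ, -, hν⟩, h⟩
    obtain ⟨κ, hκ, rfl, -⟩ := hν.2
    obtain ⟨a, σsq, M, hM⟩ := hκ.exists_hasLevyTriplet
    exact ⟨a, σsq, M, hM.1, (isFreeCounterpart_iff_transformM hk hM hν).1 h⟩
  · rintro ⟨a, σsq, M, hM, h⟩
    obtain ⟨κ, hκ, hc⟩ := exists_isLevySemigroup a σsq hM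
    obtain ⟨ν, hν⟩ := hκ.exists_isUIntegral k
    have ht : HasLevyTriplet (κ 1) a σsq M :=
      hasLevyTriplet_iff.2 ⟨hM, fun u => by simpa using hc 1 u⟩
    exact ⟨hν', ν, ⟨κ 1, hκ.isInfinitelyDivisible 1, hν⟩,
      (isFreeCounterpart_iff_transformM hk ht hν).2 h⟩

/-! ### The finite spectral measure -/

theorem measurable_spectralDensity :
    Measurable fun x : ℝ => ENNReal.ofReal (x ^ 2 / (1 + x ^ 2)) := by fun_prop

theorem IsLevyMeasure.isFiniteMeasure_withDensity {M : Measure ℝ} (hM : IsLevyMeasure M) :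
    IsFiniteMeasure ((M.restrict {0}ᶜ).withDensity
      fun x => ENNReal.ofReal (x ^ 2 / (1 + x ^ 2))) := by
  rw [hM.restrict_eq]
  refine MeasureTheory.isFiniteMeasure_withDensity
    ((lintegral_mono fun x => ?_).trans_lt hM.2).ne
  refine ENNReal.ofReal_le_ofReal (le_min ?_ ?_)
  · exact (div_le_one (by positivity)).2 (by linarith)
  · exact div_le_self (sq_nonneg x) (by linarith [sq_nonneg x])

theorem IsLevyMeasure.isFiniteMeasure_finiteSpectralMeasure {M : Measure ℝ}
    (hM : IsLevyMeasure M) (σsq : ℝ≥0) : IsFiniteMeasure (finiteSpectralMeasure σsq M) := by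
  have := hM.isFiniteMeasure_withDensity
  have : IsFiniteMeasure ((σsq : ℝ≥0∞) • Measure.dirac (0 : ℝ)) :=
    Measure.smul_finite _ ENNReal.coe_ne_top
  unfold finiteSpectralMeasure
  infer_instance

/-- The density `x²/(1+x²)` cancels the last factor of `kernelm`, and `k · it · (1/k) = it`. At `x =
0` the density vanishes, so there the Gaussian term comes from the Dirac part alone. -/
theorem spectralDensity_smul_kernelm {k : ℕ} (hk : 1 ≤ k) (t : ℝ) {x : ℝ} (hx : x ≠ 0) :
    (ENNReal.ofReal (x ^ 2 / (1 + x ^ 2))).toReal • kernelm k t x = kernelM k t x := by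
  have hk0 : (k : ℂ) ≠ 0 := by exact_mod_cast (by omega : k ≠ 0)
  have hxc : (x : ℂ) ≠ 0 := by exact_mod_cast hx
  have h1 := one_add_ofReal_sq_ne_zero x
  rw [ENNReal.toReal_ofReal (by positivity), Complex.real_smul, kernelm, if_neg hx, kernelM]
  have e : k * (Complex.I * t) * (hurwitzLerch (x / (Complex.I * t)) 1 k - (k : ℂ)⁻¹) =
      k * (Complex.I * t) * hurwitzLerch (x / (Complex.I * t)) 1 k - Complex.I * t := by
    linear_combination -(Complex.I * t) * mul_inv_cancel₀ hk0
  rw [e]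
  push_cast
  rw [mul_comm, mul_assoc, div_mul_div_cancel₀ (pow_ne_zero 2 hxc), div_self h1, mul_one]

theorem IsLevyMeasure.integrable_kernelm {M : Measure ℝ} (hM : IsLevyMeasure M) {k : ℕ}
    (hk : 1 ≤ k) {t : ℝ} (ht : 0 < t) :
    Integrable (kernelm k t) ((M.restrict {0}ᶜ).withDensity
      fun x => ENNReal.ofReal (x ^ 2 / (1 + x ^ 2))) := by
  rw [integrable_withDensity_iff_integrable_smul' measurable_spectralDensity
    (ae_of_all _ fun x => ENNReal.ofReal_lt_top)]
  refine ((hM.integrable_kernelM hk ht).integrableOn (s := {0}ᶜ)).congr ?_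
  filter_upwards [ae_restrict_mem (measurableSet_singleton (0 : ℝ)).compl] with x hx
  exact (spectralDensity_smul_kernelm hk t hx).symm

theorem integrable_kernelm_dirac (k : ℕ) (t : ℝ) (σsq : ℝ≥0) :
    Integrable (kernelm k t) ((σsq : ℝ≥0∞) • Measure.dirac (0 : ℝ)) :=
  (integrable_dirac (by simp)).smul_measure ENNReal.coe_ne_top

theorem IsLevyMeasure.integrable_kernelm_finiteSpectralMeasure {M : Measure ℝ}
    (hM : IsLevyMeasure M) (σsq : ℝ≥0) {k : ℕ} (hk : 1 ≤ k) {t : ℝ} (ht : 0 < t) :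
    Integrable (kernelm k t) (finiteSpectralMeasure σsq M) :=
  (hM.integrable_kernelm hk ht).add_measure (integrable_kernelm_dirac k t σsq)

theorem IsLevyMeasure.transformM_eq_transformm {M : Measure ℝ} (hM : IsLevyMeasure M) (a : ℝ)
    (σsq : ℝ≥0) {k : ℕ} (hk : 1 ≤ k) {t : ℝ} (ht : 0 < t) :
    transformM k a σsq M t = transformm k a (finiteSpectralMeasure σsq M) t := by
  rw [transformM, transformm, finiteSpectralMeasure,
    integral_add_measure (hM.integrable_kernelm hk ht) (integrable_kernelm_dirac k t σsq),
    integral_smul_measure, integral_dirac,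
    integral_withDensity_eq_integral_toReal_smul measurable_spectralDensity
      (ae_of_all _ fun x => ENNReal.ofReal_lt_top),
    setIntegral_congr_fun (measurableSet_singleton (0 : ℝ)).compl
      fun x hx => spectralDensity_smul_kernelm hk t hx, kernelm, if_pos rfl]
  simp only [ENNReal.coe_toReal, Complex.real_smul]
  ring

end

theorem proposition2 (k : ℕ) (hk : 1 ≤ k) (ν' : Measure ℝ) (hν' : IsProbabilityMeasure ν') :
    -- membership in the class of free counterparts
    (FreeClassU k ν' ↔
      ∃ (a : ℝ) (σsq : ℝ≥0) (M : Measure ℝ), IsLevyMeasure M ∧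
        VoiculescuOnAxis ν' (transformM k a σsq M)) ∧
    -- the parameters are those of the background driving law `μ = [a, σ², M]`
    (∀ (a : ℝ) (σsq : ℝ≥0) (M μ ν : Measure ℝ), IsInfinitelyDivisible μ →
      HasLevyTriplet μ a σsq M → IsUIntegral k μ ν →
        (IsFreeCounterpart ν ν' ↔ VoiculescuOnAxis ν' (transformM k a σsq M))) ∧
    -- the two forms of the formula agree, with absolutely convergent integrals
    (∀ (a : ℝ) (σsq : ℝ≥0) (M : Measure ℝ), IsLevyMeasure M →
      IsFiniteMeasure (finiteSpectralMeasure σsq M) ∧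
      ∀ t : ℝ, 0 < t →
        IntegrableOn (kernelM k t) {0}ᶜ M ∧
        Integrable (kernelm k t) (finiteSpectralMeasure σsq M) ∧
        transformM k a σsq M t = transformm k a (finiteSpectralMeasure σsq M) t) := by
  refine ⟨freeClassU_iff hk hν', fun a σsq M μ ν _ hμ hν =>
    isFreeCounterpart_iff_transformM hk hμ hν, fun a σsq M hM =>
    ⟨hM.isFiniteMeasure_finiteSpectralMeasure σsq, fun t ht =>
      ⟨(hM.integrable_kernelM hk ht).integrableOn,
        hM.integrable_kernelm_finiteSpectralMeasure σsq hk ht,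
        hM.transformM_eq_transformm a σsq hk ht⟩⟩⟩
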